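/- Let $(\mathcal A,\phi)$ be a unital C*-algebra with a state $\phi$. Let $H$ be a real Hilbert space, let $\mathcal H=H\otimes\mathbb C$ be its complexification, and let $\langle\cdot,\cdot\rangle$ also denote the complex-bilinear extension to $\mathcal H$ of the inner product of $H$. For each positive integer $N$ let $$S_N:\mathcal H\to M_N(\mathcal A),\qquad S_N(f)=[c^{(N)}_{i,j}(f)]_{i,j=1}^N,$$ be a complex-linear map such that (i) $\phi\big(c^{(N)}_{i,j}(f)\,c^{(N)}_{k,l}(g)\big)=\frac1N\,\delta_{i,l}\,\delta_{j,k}\,\langle f,g\rangle$ for all $f,g\in\mathcal H$ and $1\le i,j,k,l\le N$; (ii) $S_N(h)^*=S_N(h)$ for all $h\in H$; (iii) for every $h\in H$ the real and imaginary parts $\Re c^{(N)}_{i,j}(h)$, $\Im c^{(N)}_{i,j}(h)$ are centered semicircular elements (where $0$ counts as the semicircular element of variance $0$), and for all orthonormal $e_1,\dots,e_p\in H$ the family $\{\Re c^{(N)}_{i,j}(e_q),\ \Im c^{(N)}_{i,j}(e_q): 1\le q\le p,\ 1\le i\le j\le N\}$ is free with respect to $\phi$. Let $\kappa_r$ denote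 the $r$-th free cumulant with respect to $\phi$, and $\mathrm{Tr}$ the unnormalized trace $M_N(\mathcal A)\to\mathcal A$. (a) Let $r\ge1$, $l_1,\dots,l_r\ge1$ and $f_{k,q}\in\mathcal H$ for $1\le k\le r$, $1\le q\le l_k$, and put $Y^{(N)}_k=S_N(f_{k,1})S_N(f_{k,2})\cdots S_N(f_{k,l_k})$. Then, as $N\to\infty$, $$\kappa_r\big(\mathrm{Tr}(Y^{(N)}_1),\dots,\mathrm{Tr}(Y^{(N)}_r)\big)=O(N^{2-r}).$$ (b) The ensemble $\{S_N(f)\}_{f\in\mathcal H,\,N\ge1}$ has a second order free limit distribution; that is: - for all $n$ and $f_1,\dots,f_n\in\mathcal H$, the limit $\lim_{N\to\infty}\frac1N\phi\big(\mathrm{Tr}(S_N(f_1)\cdots S_N(f_n))\big)$ exists and is finite; - for all $n$, all $f_1,\dots,f_n\in\mathcal H$ and all non-commutative polynomials $p_1,p_2,\dots$ in $n$ variables with complex coefficients, writing $P^{(N)}_k=p_k(S_N(f_1),\dots,S_N(f_n))$, the limit $\lim_{N\to\infty}\kappa_2\big(\mathrm{Tr}(P^{(N)}_1),\mathrm{Tr}(P^{(N)}_2)\big)$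 exists and is finite, and $\lim_{N\to\infty}\kappa_r\big(\mathrm{Tr}(P^{(N)}_1),\dots,\mathrm{Tr}(P^{(N)}_r)\big)=0$ for every $r\ge3$. -/

import Mathlib

open Filter Topology Asymptotics
open scoped TensorProduct ComplexOrder ComplexStarModule

namespace FreeSemicircular

/-! ### Non-crossing partitions and free cumulants -/

/-- A partition of the ordered set `Fin n` is non-crossing if there are no two distinct blocks
`B`, `D` and `i < j < k < l` with `i, k ∈ B` and `j, l ∈ D`. -/
def IsNonCrossing {n : ℕ} (σ : Finpartition (Finset.univ : Finset (Fin n))) : Prop :=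
  ∀ B ∈ σ.parts, ∀ D ∈ σ.parts, B ≠ D →
    ¬ ∃ i j k l : Fin n, i < j ∧ j < k ∧ k < l ∧ i ∈ B ∧ k ∈ B ∧ j ∈ D ∧ l ∈ D

open Classical in
/-- `NC(n)`, the set of non-crossing partitions of an ordered set with `n` elements. -/
noncomputable def NC (n : ℕ) : Finset (Finpartition (Finset.univ : Finset (Fin n))) :=
  Finset.univ.filter IsNonCrossing

open Classical in
/-- The non-crossing partitions of an `n`-element set other than the one-block partition. -/
noncomputable def properNC (n : ℕ) : Finset (Finpartition (Finset.univ : Finset (Fin n))) :=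
  (NC n).filter fun σ => Finset.univ ∉ σ.parts

theorem card_lt_of_mem_properNC {n : ℕ} {σ : Finpartition (Finset.univ : Finset (Fin n))}
    (hσ : σ ∈ properNC n) {B : Finset (Fin n)} (hB : B ∈ σ.parts) : B.card < n := by
  classical
  have h1 : (Finset.univ : Finset (Fin n)) ∉ σ.parts := (Finset.mem_filter.1 hσ).2
  have h2 : B ≠ Finset.univ := fun h => h1 (h ▸ hB)
  have h3 := Finset.card_lt_card (Finset.ssubset_univ_iff.2 h2)
  simpa using h3

/-- The `n`-th free cumulant `κ_n(X_1, …, X_n)` with respect to `φ`, obtained by solving the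
moment-cumulant recurrence
`φ(X_1 ⋯ X_n) = ∑_{σ ∈ NC(n)} ∏_{B ∈ σ} κ_{|B|}(X_b : b ∈ B)`
for the term of the one-block partition. The elements of a block are listed in increasing order.
See `moment_eq_sum_freeCumulant` for the recurrence itself. -/
noncomputable def freeCumulant {A : Type*} [Ring A] [Algebra ℂ A] (φ : A →ₗ[ℂ] ℂ) :
    (n : ℕ) → (Fin n → A) → ℂ
  | n, X => φ (List.ofFn X).prod -
      ∑ σ : {σ // σ ∈ properNC n}, ∏ B : {B // B ∈ σ.1.parts},
        freeCumulant φ B.1.card (fun i => X (B.1.orderEmbOfFin rfl i))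
  termination_by n => n
  decreasing_by exact card_lt_of_mem_properNC σ.2 B.2

theorem freeCumulant_block {A : Type*} [Ring A] [Algebra ℂ A] (φ : A →ₗ[ℂ] ℂ) {n m : ℕ}
    (h : m = n) (X : Fin n → A) (e : Fin m ↪o Fin n) :
    freeCumulant φ m (fun i => X (e i)) = freeCumulant φ n X := by
  subst h
  have hsurj : Function.Surjective e := Finite.surjective_of_injective e.injective
  have h1 : StrictMono.orderIsoOfSurjective e e.strictMono hsurj = OrderIso.refl _ :=
    Subsingleton.elim _ _
  have h2 : ∀ i, e i = i := fun i => congrArg (fun g : Fin m ≃o Fin m => g i) h1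
  simp only [h2]

/-- The moment-cumulant recurrence that defines the free cumulants. -/
theorem moment_eq_sum_freeCumulant {A : Type*} [Ring A] [Algebra ℂ A] (φ : A →ₗ[ℂ] ℂ)
    (n : ℕ) (hn : 1 ≤ n) (X : Fin n → A) :
    φ (List.ofFn X).prod = ∑ σ ∈ NC n, ∏ B ∈ σ.parts,
      freeCumulant φ B.card (fun i => X (B.orderEmbOfFin rfl i)) := by
  classical
  have hne : (Finset.univ : Finset (Fin n)) ≠ ∅ :=
    (Finset.univ_nonempty_iff.2 ⟨⟨0, hn⟩⟩).ne_empty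
  have hsplit := Finset.sum_filter_add_sum_filter_not (NC n)
    (fun σ => (Finset.univ : Finset (Fin n)) ∉ σ.parts)
    (fun σ => ∏ B ∈ σ.parts, freeCumulant φ B.card (fun i => X (B.orderEmbOfFin rfl i)))
  let τ : Finpartition (Finset.univ : Finset (Fin n)) := Finpartition.indiscrete hne
  have hτp : τ.parts = {Finset.univ} := rfl
  have huniq : ((NC n).filter
      fun σ => ¬ ((Finset.univ : Finset (Fin n)) ∉ σ.parts)) = {τ} := by
    ext σ
    simp only [NC, Finset.mem_filter, Finset.mem_univ, true_and, not_not,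
      Finset.mem_singleton]
    constructor
    · rintro ⟨-, h⟩
      ext B
      rw [hτp, Finset.mem_singleton]
      constructor
      · intro hB
        by_contra hBu
        have hd := σ.disjoint hB h hBu
        exact σ.ne_bot hB (disjoint_top.1 hd)
      · rintro rfl
        exact h
    · rintro rfl
      refine ⟨?_, by simp [hτp]⟩
      intro B hB D hD hBD
      rw [hτp, Finset.mem_singleton] at hB hD
      exact absurd (hB.trans hD.symm) hBD
  rw [← hsplit, huniq, Finset.sum_singleton, hτp, Finset.prod_singleton,
    freeCumulant_block φ (by simp) X]
  conv_rhs => rw [freeCumulant]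
  have hs : ∀ σ : Finpartition (Finset.univ : Finset (Fin n)),
      ∏ B : {B // B ∈ σ.parts}, freeCumulant φ B.1.card
        (fun i => X (B.1.orderEmbOfFin rfl i)) =
      ∏ B ∈ σ.parts, freeCumulant φ B.card (fun i => X (B.orderEmbOfFin rfl i)) := fun σ =>
    Finset.prod_coe_sort σ.parts
      (fun B => freeCumulant φ B.card (fun i => X (B.orderEmbOfFin rfl i)))
  simp only [hs]
  rw [Finset.sum_coe_sort (properNC n) (fun σ => ∏ B ∈ σ.parts,
    freeCumulant φ B.card (fun i => X (B.orderEmbOfFin rfl i)))]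
  simp only [properNC]
  ring

/-! ### Non-commutative probability spaces, freeness, semicircular elements -/

/-- `φ` is a state on the unital C*-algebra `A`: a unital positive linear functional. -/
structure IsState {A : Type*} [CStarAlgebra A] (φ : A →ₗ[ℂ] ℂ) : Prop where
  map_one : φ 1 = 1
  nonneg : ∀ a : A, 0 ≤ φ (star a * a)

/-- Freeness of a family of unital subalgebras: products of centered elements in which
neighbouring factors come from different members of the family are centered. -/
def AreFree {A : Type*} [Ring A] [Algebra ℂ A] (φ : A →ₗ[ℂ] ℂ) {ι : Type*}
    (𝒜 : ι → Subalgebra ℂ A) : Prop :=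
  ∀ (n : ℕ) (ε : Fin n → ι) (a : Fin n → A), 1 ≤ n →
    (∀ k, a k ∈ 𝒜 (ε k)) → (∀ k, φ (a k) = 0) →
    (∀ j k : Fin n, (k : ℕ) = j + 1 → ε j ≠ ε k) →
    φ (List.ofFn a).prod = 0

/-- Freeness of a family of self-adjoint elements: freeness of the unital subalgebras that they
generate. -/
def AreFreeElements {A : Type*} [Ring A] [Algebra ℂ A] (φ : A →ₗ[ℂ] ℂ) {ι : Type*}
    (x : ι → A) : Prop :=
  AreFree φ fun i => Algebra.adjoin ℂ {x i}

/-- `x` is a centered semicircular element of variance `v`: it is self-adjoint, `κ_2(x, x) = v`,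
and its other free cumulants vanish. (The variance `0` is allowed here: it is that of the
imaginary parts of the diagonal entries of a self-adjoint matrix, which are `0`.) -/
def IsSemicircular {A : Type*} [CStarAlgebra A] (φ : A →ₗ[ℂ] ℂ) (x : A) (v : ℝ) : Prop :=
  IsSelfAdjoint x ∧ 0 ≤ v ∧
    ∀ n : ℕ, 1 ≤ n → freeCumulant φ n (fun _ => x) = if n = 2 then (v : ℂ) else 0

/-! ### Ensembles of semicircular random matrices -/

/-- The complex-bilinear extension of the inner product of the real Hilbert space `H` to its
complexification `ℂ ⊗[ℝ] H`. -/
noncomputable def pairing {H : Type*} [NormedAddCommGroup H] [InnerProductSpace ℝ H] :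
    LinearMap.BilinForm ℂ (ℂ ⊗[ℝ] H) :=
  LinearMap.BilinForm.baseChange ℂ (innerₗ H : LinearMap.BilinForm ℝ H)

/-- The real or imaginary part (according to the Boolean) of an element. -/
noncomputable def reIm {A : Type*} [CStarAlgebra A] (b : Bool) (a : A) : A :=
  if b then (ℜ a : A) else (ℑ a : A)

/-- An ensemble `S_N(f)` of semicircular random matrices over `(A, φ)`, indexed (linearly) by the
vectors `f` of the complexification of the real Hilbert space `H`. -/
structure IsSemicircularEnsemble {A : Type*} [CStarAlgebra A] (φ : A →ₗ[ℂ] ℂ)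
    {H : Type*} [NormedAddCommGroup H] [InnerProductSpace ℝ H]
    (S : (N : ℕ) → (ℂ ⊗[ℝ] H) →ₗ[ℂ] Matrix (Fin N) (Fin N) A) : Prop where
  /-- the covariance of the entries -/
  covariance : ∀ (N : ℕ) (f g : ℂ ⊗[ℝ] H) (i j k l : Fin N),
    φ (S N f i j * S N g k l) =
      if i = l ∧ j = k then (1 / (N : ℂ)) * pairing f g else 0
  /-- the matrices of real vectors are self-adjoint -/
  selfAdjoint : ∀ (N : ℕ) (h : H), IsSelfAdjoint (S N ((1 : ℂ) ⊗ₜ[ℝ] h))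
  /-- the real and imaginary parts of the entries are centered semicircular elements -/
  semicircular : ∀ (N : ℕ) (h : H) (i j : Fin N) (b : Bool),
    ∃ v : ℝ, IsSemicircular φ (reIm b (S N ((1 : ℂ) ⊗ₜ[ℝ] h) i j)) v
  /-- for orthonormal vectors of `H`, the real and imaginary parts of the entries on and above
  the diagonal of all the corresponding matrices form a free family -/
  free : ∀ (N p : ℕ) (e : Fin p → H), Orthonormal ℝ e →
    AreFreeElements φ fun x : Fin p × {q : Fin N × Fin N // q.1 ≤ q.2} × Bool =>
      reIm x.2.2 (S N ((1 : ℂ) ⊗ₜ[ℝ] e x.1) x.2.1.1.1 x.2.1.1.2)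

/-! ### Limit distributions of first and second order -/

/-- An ensemble of random matrices has limit distribution if all the expectations of normalized
traces of products of its members converge. -/
def HasLimitDistribution {A : Type*} [CStarAlgebra A] (φ : A →ₗ[ℂ] ℂ) {I : Type*}
    (M : I → (N : ℕ) → Matrix (Fin N) (Fin N) A) : Prop :=
  ∀ (n : ℕ) (i : Fin n → I), ∃ L : ℂ,
    Tendsto (fun N : ℕ => (1 / (N : ℂ)) *
      φ (Matrix.trace (List.ofFn fun p => M (i p) N).prod)) atTop (𝓝 L)

/-- The element `Tr(p(A_{i_1,N}, …, A_{i_n,N}))` for a non-commutative polynomial `p`. -/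
noncomputable def polyTrace {A : Type*} [CStarAlgebra A] {I : Type*}
    (M : I → (N : ℕ) → Matrix (Fin N) (Fin N) A) {n : ℕ} (i : Fin n → I)
    (p : FreeAlgebra ℂ (Fin n)) (N : ℕ) : A :=
  Matrix.trace (FreeAlgebra.lift ℂ (fun j => M (i j) N) p)

/-- An ensemble of random matrices has second order free limit distribution if it has limit
distribution, the second free cumulants of unnormalized traces of polynomials in its members
converge, and the higher ones tend to `0`. -/
def HasSecondOrderFreeLimitDistribution {A : Type*} [CStarAlgebra A] (φ : A →ₗ[ℂ] ℂ)
    {I : Type*} (M : I → (N : ℕ) → Matrix (Fin N) (Fin N) A) : Prop :=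
  HasLimitDistribution φ M ∧
  ∀ (n : ℕ) (i : Fin n → I),
    (∀ p : Fin 2 → FreeAlgebra ℂ (Fin n), ∃ L : ℂ,
      Tendsto (fun N : ℕ => freeCumulant φ 2 fun k => polyTrace M i (p k) N) atTop (𝓝 L)) ∧
    (∀ r : ℕ, 3 ≤ r → ∀ p : Fin r → FreeAlgebra ℂ (Fin n),
      Tendsto (fun N : ℕ => freeCumulant φ r fun k => polyTrace M i (p k) N) atTop (𝓝 0))

end FreeSemicircular

set_option linter.unusedSectionVars false

namespace FreeSemicircular

/-! ### Non-crossing partitions of finite subsets of a linear order -/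

/-! Expand every trace into entries. Let `E` be the set of all letters of the `r` words, in reading
order, and let `γ` rotate each word cyclically. By multilinearity the cumulant is a sum over index
functions `c : E → Fin N`, in which the letter `e` contributes its entry at `(c e, c (γ e))`. The
formula for free cumulants with products as entries (`cum_orderedProd`) turns each term into a sum,
over the non-crossing partitions `P` of `E` that connect all the words, of products of cumulants of
entries.

Every entry is a linear combination of members of a free semicircular family. Mixed cumulants of
free elements vanish (`AreFree.freeCumulant_eq_zero`), so only cumulants of order two survive
(`IsSemicircularEnsemble.freeCumulant_entries`) and `P` must be a pairing, given by an involution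
`s`. By the covariance condition a pairing contributes a constant times `N ^ (-|P|)` for each `c`
that is constant on the cycles of `γ * s`, so in total a constant times `N ^ (#(γ * s) - |P|)`,
where `#` counts cycles, fixed points included.

The exponent is bounded by Euler's inequality `#(γ * s) + #γ ≤ |P| + 2 * #orbits`
(`numClasses_mul_involution_le`). Connectedness leaves at most one orbit of the group generated by
`γ` and `s`, and `#γ` is at least `r`, whence the exponent is at most `2 - r`. Non-crossingness is
not needed for this count; it enters only through the cumulants.

The cumulant is thus a Laurent polynomial in `N` of degree at most `2 - r` for `N ≥ 1`. This gives
the bound in (a), and also the limits in (b): degree at most `0` forces convergence, negative degree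
convergence to `0`. Polynomials reduce to words by multilinearity; the empty word has trace `N • 1`,
which kills every cumulant of order at least two. -/

/-- The set `P` of blocks is a non-crossing partition of the finite set `D`. -/
structure IsNCP {E : Type*} [LinearOrder E] (P : Finset (Finset E)) (D : Finset E) : Prop where
  nonempty : ∀ B ∈ P, B.Nonempty
  subset : ∀ B ∈ P, B ⊆ D
  cover : ∀ e ∈ D, ∃ B ∈ P, e ∈ B
  disj : ∀ B ∈ P, ∀ C ∈ P, ∀ e, e ∈ B → e ∈ C → B = C
  noncrossing : ∀ B ∈ P, ∀ C ∈ P, B ≠ C → ∀ i j k l, i < j → j < k → k < l →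
    i ∈ B → k ∈ B → j ∈ C → l ∈ C → False

open Classical in
/-- The non-crossing partitions of a finite subset of a linear order, as sets of blocks. -/
noncomputable def ncp {E : Type*} [LinearOrder E] (D : Finset E) : Finset (Finset (Finset E)) :=
  D.powerset.powerset.filter fun P => IsNCP P D

section
variable {E F : Type*} [LinearOrder E] [LinearOrder F]

theorem mem_ncp {P : Finset (Finset E)} {D : Finset E} : P ∈ ncp D ↔ IsNCP P D := by
  classical
  simp only [ncp, Finset.mem_filter, Finset.mem_powerset, and_iff_right_iff_imp]
  intro h B hB
  exact Finset.mem_powerset.2 (h.subset B hB)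

theorem isNCP_singleton {D : Finset E} (hD : D.Nonempty) : IsNCP {D} D where
  nonempty := by simpa using hD
  subset := by simp
  cover := by simp
  disj := by simp
  noncrossing := by
    intro B hB C hC h
    exact absurd ((Finset.mem_singleton.1 hB).trans (Finset.mem_singleton.1 hC).symm) h

theorem IsNCP.eq_singleton {P : Finset (Finset E)} {D : Finset E} (h : IsNCP P D) (hD : D ∈ P) :
    P = {D} := by
  ext B
  rw [Finset.mem_singleton]
  constructor
  · intro hB
    obtain ⟨e, he⟩ := h.nonempty B hB
    exact h.disj B hB D hD e he (h.subset B hB he)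
  · rintro rfl
    exact hD

theorem ncp_empty : ncp (∅ : Finset E) = {∅} := by
  ext P
  rw [mem_ncp, Finset.mem_singleton]
  constructor
  · intro h
    refine Finset.eq_empty_of_forall_notMem fun B hB => ?_
    obtain ⟨e, he⟩ := h.nonempty B hB
    exact absurd (h.subset B hB he) (Finset.notMem_empty e)
  · rintro rfl
    constructor <;> simp

/-- Isolating the one-block partition in a sum over non-crossing partitions. -/
theorem sum_ncp_eq_add {D : Finset E} (hD : D.Nonempty) (f : Finset (Finset E) → ℂ) :
    ∑ P ∈ ncp D, f P = f {D} + ∑ P ∈ (ncp D).erase {D}, f P :=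
  (Finset.add_sum_erase _ _ (mem_ncp.2 (isNCP_singleton hD))).symm

theorem IsNCP.ssubset {P : Finset (Finset E)} {D : Finset E} (h : P ∈ (ncp D).erase {D})
    {B : Finset E} (hB : B ∈ P) : B ⊂ D := by
  rw [Finset.mem_erase, mem_ncp] at h
  refine lt_of_le_of_ne (h.2.subset B hB) ?_
  rintro rfl
  exact h.1 (h.2.eq_singleton hB)

/-- Two functions of finite sets with the same sums over non-crossing partitions agree. -/
theorem eq_of_sum_ncp_eq (K K' : Finset E → ℂ)
    (h : ∀ D : Finset E, D.Nonempty →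
      ∑ P ∈ ncp D, ∏ B ∈ P, K B = ∑ P ∈ ncp D, ∏ B ∈ P, K' B)
    (D : Finset E) (hD : D.Nonempty) : K D = K' D := by
  induction D using Finset.strongInduction with
  | H D ih =>
    have h1 := h D hD
    rw [sum_ncp_eq_add hD, sum_ncp_eq_add hD] at h1
    have h2 : ∑ P ∈ (ncp D).erase {D}, ∏ B ∈ P, K B = ∑ P ∈ (ncp D).erase {D}, ∏ B ∈ P, K' B := by
      refine Finset.sum_congr rfl fun P hP => Finset.prod_congr rfl fun B hB => ?_
      exact ih B (IsNCP.ssubset hP hB) ((mem_ncp.1 (Finset.mem_of_mem_erase hP)).nonempty B hB)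
    rw [h2] at h1
    simpa using h1

theorem IsNCP.map (g : F ↪o E) {P : Finset (Finset F)} {D : Finset F} (h : IsNCP P D) :
    IsNCP (P.image fun B => B.map g.toEmbedding) (D.map g.toEmbedding) where
  nonempty := by
    simp only [Finset.mem_image, forall_exists_index, and_imp, forall_apply_eq_imp_iff₂]
    intro B hB
    exact (h.nonempty B hB).map
  subset := by
    simp only [Finset.mem_image, forall_exists_index, and_imp, forall_apply_eq_imp_iff₂]
    intro B hB
    exact Finset.map_subset_map.2 (h.subset B hB)
  cover := by
    intro e he
    obtain ⟨a, ha, rfl⟩ := Finset.mem_map.1 he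
    obtain ⟨B, hB, haB⟩ := h.cover a ha
    exact ⟨_, Finset.mem_image_of_mem _ hB, Finset.mem_map_of_mem _ haB⟩
  disj := by
    simp only [Finset.mem_image, forall_exists_index, and_imp, forall_apply_eq_imp_iff₂]
    intro B hB C hC e he he'
    obtain ⟨a, ha, rfl⟩ := Finset.mem_map.1 he
    rw [h.disj B hB C hC a ha ((Finset.mem_map' _).1 he')]
  noncrossing := by
    simp only [Finset.mem_image, forall_exists_index, and_imp, forall_apply_eq_imp_iff₂]
    intro B hB C hC hne i j k l hij hjk hkl hi hk hj hl
    obtain ⟨i, hi', rfl⟩ := Finset.mem_map.1 hi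
    obtain ⟨j, hj', rfl⟩ := Finset.mem_map.1 hj
    obtain ⟨k, hk', rfl⟩ := Finset.mem_map.1 hk
    obtain ⟨l, hl', rfl⟩ := Finset.mem_map.1 hl
    exact h.noncrossing B hB C hC (fun h => hne (h ▸ rfl)) i j k l (g.lt_iff_lt.1 hij)
      (g.lt_iff_lt.1 hjk) (g.lt_iff_lt.1 hkl) hi' hk' hj' hl'

open Classical in
theorem IsNCP.exists_map (g : F ↪o E) {Q : Finset (Finset E)} {D : Finset F}
    (h : IsNCP Q (D.map g.toEmbedding)) :
    ∃ P : Finset (Finset F), IsNCP P D ∧ (P.image fun B => B.map g.toEmbedding) = Q := by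
  have hex : ∀ B ∈ Q, ∃ C ⊆ D, C.map g.toEmbedding = B := fun B hB => by
    obtain ⟨C, hC, rfl⟩ := Finset.subset_map_iff.1 (h.subset B hB)
    exact ⟨C, hC, rfl⟩
  refine ⟨D.powerset.filter fun C => C.map g.toEmbedding ∈ Q, ?_, ?_⟩
  · constructor
    · intro B hB
      have := h.nonempty _ (Finset.mem_filter.1 hB).2
      simpa using this
    · intro B hB
      exact Finset.mem_powerset.1 (Finset.mem_filter.1 hB).1
    · intro e he
      obtain ⟨B, hB, heB⟩ := h.cover _ (Finset.mem_map_of_mem _ he)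
      obtain ⟨C, hC, rfl⟩ := hex B hB
      exact ⟨C, Finset.mem_filter.2 ⟨Finset.mem_powerset.2 hC, hB⟩, (Finset.mem_map' _).1 heB⟩
    · intro B hB C hC e he he'
      exact Finset.map_injective g.toEmbedding <| h.disj _ (Finset.mem_filter.1 hB).2 _
        (Finset.mem_filter.1 hC).2 (g e)
        (Finset.mem_map_of_mem _ he) (Finset.mem_map_of_mem _ he')
    · intro B hB C hC hne i j k l hij hjk hkl hi hk hj hl
      exact h.noncrossing _ (Finset.mem_filter.1 hB).2 _ (Finset.mem_filter.1 hC).2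
        (fun h => hne (Finset.map_injective _ h)) (g i) (g j) (g k) (g l) (g.lt_iff_lt.2 hij)
        (g.lt_iff_lt.2 hjk) (g.lt_iff_lt.2 hkl) (Finset.mem_map_of_mem _ hi)
        (Finset.mem_map_of_mem _ hk) (Finset.mem_map_of_mem _ hj) (Finset.mem_map_of_mem _ hl)
  · ext B
    simp only [Finset.mem_image, Finset.mem_filter, Finset.mem_powerset]
    constructor
    · rintro ⟨C, ⟨-, hC⟩, rfl⟩
      exact hC
    · intro hB
      obtain ⟨C, hC, rfl⟩ := hex B hB
      exact ⟨C, ⟨hC, hB⟩, rfl⟩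

theorem sum_ncp_map (g : F ↪o E) (D : Finset F) (K : Finset E → ℂ) :
    ∑ P ∈ ncp (D.map g.toEmbedding), ∏ B ∈ P, K B =
      ∑ P ∈ ncp D, ∏ B ∈ P, K (B.map g.toEmbedding) := by
  classical
  symm
  refine Finset.sum_bij (fun P _ => P.image fun B => B.map g.toEmbedding) ?_ ?_ ?_ ?_
  · intro P hP
    exact mem_ncp.2 ((mem_ncp.1 hP).map g)
  · intro P _ Q _ h
    exact Finset.image_injective (Finset.map_injective g.toEmbedding) h
  · intro Q hQ
    obtain ⟨P, hP, hPQ⟩ := (mem_ncp.1 hQ).exists_map g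
    exact ⟨P, mem_ncp.2 hP, hPQ⟩
  · intro P _
    rw [Finset.prod_image]
    exact fun B _ C _ h => Finset.map_injective g.toEmbedding h

/-- Partitions as bare sets of blocks have a type that does not depend on the underlying set, so
partitions of different subsets can be restricted and glued without casts. -/
theorem sum_NC_eq_sum_ncp (n : ℕ) (K : Finset (Fin n) → ℂ) :
    ∑ σ ∈ NC n, ∏ B ∈ σ.parts, K B = ∑ P ∈ ncp (Finset.univ : Finset (Fin n)), ∏ B ∈ P, K B := by
  classical
  refine Finset.sum_bij (fun σ _ => σ.parts) ?_ ?_ ?_ ?_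
  · intro σ hσ
    rw [mem_ncp]
    have hσ' : IsNonCrossing σ := (Finset.mem_filter.1 hσ).2
    constructor
    · exact fun B hB => σ.nonempty_of_mem_parts hB
    · exact fun B _ => Finset.subset_univ B
    · exact fun e he => σ.exists_mem he
    · exact fun B hB C hC e he he' => σ.eq_of_mem_parts hB hC he he'
    · intro B hB C hC hne i j k l hij hjk hkl hi hk hj hl
      exact hσ' B hB C hC hne ⟨i, j, k, l, hij, hjk, hkl, hi, hk, hj, hl⟩
  · intro σ _ τ _ h
    exact Finpartition.ext h
  · intro P hP
    have hP' := mem_ncp.1 hP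
    refine ⟨Finpartition.ofExistsUnique P hP'.subset (fun a ha => ?_) (fun h => ?_), ?_, rfl⟩
    · obtain ⟨B, hB, haB⟩ := hP'.cover a ha
      exact ⟨B, ⟨hB, haB⟩, fun C hC => hP'.disj C hC.1 B hB a hC.2 haB⟩
    · exact absurd (hP'.nonempty _ h) Finset.not_nonempty_empty
    · refine Finset.mem_filter.2 ⟨Finset.mem_univ _, ?_⟩
      rintro B hB C hC hne ⟨i, j, k, l, hij, hjk, hkl, hi, hk, hj, hl⟩
      exact hP'.noncrossing B hB C hC hne i j k l hij hjk hkl hi hk hj hl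
  · intro σ _
    rfl

end

/-! ### Moments and cumulants of subfamilies -/

section
variable {E F : Type*} [LinearOrder E] [LinearOrder F]

/-- The product of a family over a finite set, in increasing order. -/
noncomputable def orderedProd {A : Type*} [Ring A] (x : E → A) (D : Finset E) : A :=
  (D.sort.map x).prod

theorem orderedProd_eq_ofFn {A : Type*} [Ring A] (x : E → A) (D : Finset E) :
    orderedProd x D = (List.ofFn fun i => x (D.orderEmbOfFin rfl i)).prod := by
  rw [orderedProd, ← Finset.listMap_orderEmbOfFin_finRange D rfl, List.map_map, List.ofFn_eq_map]
  rfl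

variable {A : Type*} [Ring A] [Algebra ℂ A] (φ : A →ₗ[ℂ] ℂ)

/-- The free cumulant of the subfamily indexed by a finite set, listed in increasing order. -/
noncomputable def cum (x : E → A) (D : Finset E) : ℂ :=
  freeCumulant φ D.card fun i => x (D.orderEmbOfFin rfl i)

theorem cum_map (g : F ↪o E) (x : E → A) (D : Finset F) :
    cum φ x (D.map g.toEmbedding) = cum φ (fun i => x (g i)) D := by
  unfold cum
  have h : D.card = (D.map g.toEmbedding).card := (Finset.card_map _).symm
  rw [← freeCumulant_block φ h _ (Fin.castOrderIso h).toOrderEmbedding]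
  congr 1
  funext i
  have : (fun i => g (D.orderEmbOfFin rfl i)) = (D.map g.toEmbedding).orderEmbOfFin h.symm := by
    apply Finset.orderEmbOfFin_unique
    · intro i
      exact Finset.mem_map_of_mem _ (Finset.orderEmbOfFin_mem D rfl i)
    · exact g.strictMono.comp (D.orderEmbOfFin rfl).strictMono
  exact congrArg x (congrFun this i).symm

theorem cum_univ {n : ℕ} (x : Fin n → A) : cum φ x Finset.univ = freeCumulant φ n x :=
  freeCumulant_block φ (by simp) x _

/-- The moment-cumulant formula for a subfamily. -/
theorem moment_eq_sum_cum (x : E → A) (D : Finset E) (hD : D.Nonempty) :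
    φ (orderedProd x D) = ∑ P ∈ ncp D, ∏ B ∈ P, cum φ x B := by
  rw [orderedProd_eq_ofFn, moment_eq_sum_freeCumulant φ _ hD.card_pos]
  have h := sum_ncp_map (D.orderEmbOfFin rfl) Finset.univ (cum φ x)
  have h1 : Finset.univ.map (D.orderEmbOfFin rfl).toEmbedding = D :=
    Finset.map_orderEmbOfFin_univ D rfl
  rw [h1] at h
  rw [h, sum_NC_eq_sum_ncp D.card
    (fun B => freeCumulant φ B.card fun i => x (D.orderEmbOfFin rfl (B.orderEmbOfFin rfl i)))]
  refine Finset.sum_congr rfl fun P _ => Finset.prod_congr rfl fun B _ => ?_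
  rw [cum_map]
  rfl

/-- The moment-cumulant formula over all non-empty subsets determines the cumulants. The product
formula is proved through this uniqueness rather than through Möbius inversion. -/
theorem eq_cum (x : E → A) (K : Finset E → ℂ)
    (h : ∀ D : Finset E, D.Nonempty → φ (orderedProd x D) = ∑ P ∈ ncp D, ∏ B ∈ P, K B)
    (D : Finset E) (hD : D.Nonempty) : cum φ x D = K D :=
  eq_of_sum_ncp_eq _ _ (fun D hD => (moment_eq_sum_cum φ x D hD).symm.trans (h D hD)) D hD

theorem cum_singleton (x : E → A) (e : E) : cum φ x {e} = φ (x e) := by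
  have h := moment_eq_sum_cum φ x {e} (Finset.singleton_nonempty e)
  rw [sum_ncp_eq_add (Finset.singleton_nonempty e)] at h
  have h0 : (ncp {e}).erase {{e}} = ∅ := by
    refine Finset.eq_empty_of_forall_notMem fun P hP => ?_
    have hP' := mem_ncp.1 (Finset.mem_of_mem_erase hP)
    obtain ⟨B, hB, -⟩ := hP'.cover e (Finset.mem_singleton_self e)
    exact (hP'.nonempty B hB).ne_empty (Finset.ssubset_singleton_iff.1 (IsNCP.ssubset hP hB))
  rw [h0] at h
  simpa [orderedProd] using h.symm
end

/-! ### Free cumulants with products as entries -/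

section
variable {E α : Type*} [LinearOrder E] [Fintype E] [LinearOrder α] (p : E → α)

/-- The finite set of the indices that lie over `D`. -/
def fiberOver (D : Finset α) : Finset E := Finset.univ.filter fun e => p e ∈ D

variable {p} in
theorem mem_fiberOver {D : Finset α} {e : E} : e ∈ fiberOver p D ↔ p e ∈ D := by
  simp [fiberOver]

/-- The set of blocks `P` connects the finite set `B`: no proper non-empty subset of `B` is
saturated for the blocks of `P`. -/
def Connects (P : Finset (Finset E)) (B : Finset α) : Prop :=
  ∀ S ⊆ B, S.Nonempty → (∀ C ∈ P, ∀ e ∈ C, ∀ e' ∈ C, p e ∈ S → p e' ∈ S) → S = B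

open Classical in
/-- The non-crossing partitions of the indices over `B` that connect `B`. -/
noncomputable def connectedNcp (B : Finset α) : Finset (Finset (Finset E)) :=
  (ncp (fiberOver p B)).filter fun P => Connects p P B

variable {p} in
theorem mem_connectedNcp {B : Finset α} {P : Finset (Finset E)} :
    P ∈ connectedNcp p B ↔ IsNCP P (fiberOver p B) ∧ Connects p P B := by
  simp [connectedNcp, mem_ncp]

/-- Two indices are linked if they are in the same connected component of the images of the
blocks. -/
def Linked (P : Finset (Finset E)) : α → α → Prop :=
  Relation.EqvGen fun k k' => ∃ C ∈ P, ∃ e ∈ C, ∃ e' ∈ C, p e = k ∧ p e' = k'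

open Classical in
/-- The partition of `D` into the connected components of the images of the blocks. -/
noncomputable def componentsOf (P : Finset (Finset E)) (D : Finset α) : Finset (Finset α) :=
  D.image fun k => D.filter fun k' => Linked p P k k'

variable {p}

theorem Linked.mem_iff {P : Finset (Finset E)} {k k' : α} (h : Linked p P k k') (S : Set α)
    (hS : ∀ C ∈ P, ∀ e ∈ C, ∀ e' ∈ C, p e ∈ S → p e' ∈ S) : k ∈ S ↔ k' ∈ S := by
  induction h with
  | rel k k' h =>
    obtain ⟨C, hC, e, he, e', he', rfl, rfl⟩ := h
    exact ⟨hS C hC e he e' he', hS C hC e' he' e he⟩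
  | refl => rfl
  | symm _ _ _ ih => exact ih.symm
  | trans _ _ _ _ _ ih1 ih2 => exact ih1.trans ih2

theorem linked_of_mem {P : Finset (Finset E)} {C : Finset E} (hC : C ∈ P) {e e' : E}
    (he : e ∈ C) (he' : e' ∈ C) : Linked p P (p e) (p e') :=
  Relation.EqvGen.rel _ _ ⟨C, hC, e, he, e', he', rfl, rfl⟩

theorem mem_componentsOf {P : Finset (Finset E)} {D B : Finset α} :
    B ∈ componentsOf p P D ↔ ∃ k ∈ D, ∀ k', k' ∈ B ↔ k' ∈ D ∧ Linked p P k k' := by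
  classical
  simp only [componentsOf, Finset.mem_image, Finset.ext_iff, Finset.mem_filter]
  constructor
  · rintro ⟨k, hk, h⟩
    exact ⟨k, hk, fun k' => (h k').symm⟩
  · rintro ⟨k, hk, h⟩
    exact ⟨k, hk, fun k' => (h k').symm⟩

/-- Two different connected sets do not cross. -/
theorem not_crossing_of_connects (hp : Monotone p) {P : Finset (Finset E)} {D' : Finset E}
    (hP : IsNCP P D') {B B' : Finset α} (hd : ∀ k ∈ B, k ∈ B' → False)
    (hB : Connects p (P.filter (· ⊆ fiberOver p B)) B)
    (hB' : Connects p (P.filter (· ⊆ fiberOver p B')) B')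
    {i j k l : α} (hij : i < j) (hjk : j < k) (hkl : k < l) (hi : i ∈ B) (hk : k ∈ B)
    (hj : j ∈ B') (hl : l ∈ B') : False := by
  -- An arc between two elements of one block over `B` cannot separate points of `B'`: blocks over
  -- `B'` do not cross the arc, so the part of `B'` under it is saturated, against the connectedness
  -- of `B'`.
  have key : ∀ x y : α, x ∈ B → y ∈ B → ∀ C ∈ P, ∀ e ∈ C, ∀ e' ∈ C, p e = x → p e' = y →
      C ⊆ fiberOver p B → x < y →
      ∀ u ∈ B', ∀ v ∈ B', x < u → u < y → ¬ (x < v ∧ v < y) → False := by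
    rintro _ _ hx hy C hC e he e' he' rfl rfl hCB hxy u hu v hv h1 h2 h3
    by_contra -
    have hS := hB' (B'.filter fun z => p e < z ∧ z < p e') (Finset.filter_subset _ _)
      ⟨u, Finset.mem_filter.2 ⟨hu, h1, h2⟩⟩
    have hne : B'.filter (fun z => p e < z ∧ z < p e') ≠ B' := by
      intro h
      rw [← h] at hv
      exact h3 (Finset.mem_filter.1 hv).2
    refine hne (hS ?_)
    intro C' hC' d hd1 d' hd' hdm
    obtain ⟨hC'P, hC'B⟩ := Finset.mem_filter.1 hC'
    have hd'B : p d' ∈ B' := mem_fiberOver.1 (hC'B hd')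
    have hdB : p d ∈ B' := mem_fiberOver.1 (hC'B hd1)
    have hCC : C ≠ C' := by
      rintro rfl
      exact hd _ (mem_fiberOver.1 (hCB hd1)) hdB
    obtain ⟨-, hd2, hd3⟩ := Finset.mem_filter.1 hdm
    refine Finset.mem_filter.2 ⟨hd'B, ?_, ?_⟩
    · by_contra hlt
      have hlt' : p d' < p e := lt_of_le_of_ne (not_lt.1 hlt) fun h => hd _ hx (h ▸ hd'B)
      exact hP.noncrossing C' hC'P C hC hCC.symm d' e d e' (hp.reflect_lt hlt')
        (hp.reflect_lt hd2) (hp.reflect_lt hd3) hd' hd1 he he'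
    · by_contra hlt
      have hlt' : p e' < p d' := lt_of_le_of_ne (not_lt.1 hlt) fun h => hd _ hy (h ▸ hd'B)
      exact hP.noncrossing C hC C' hC'P hCC e d e' d' (hp.reflect_lt hd2)
        (hp.reflect_lt hd3) (hp.reflect_lt hlt') he he' hd1 hd'
  -- The part of `B` between `j` and `l` contains `k` but not `i`, so some block must leave this
  -- interval. Its arc then has exactly one of `j`, `l` under it, which `key` forbids.
  have hS := hB (B.filter fun z => j < z ∧ z < l) (Finset.filter_subset _ _)
      ⟨k, Finset.mem_filter.2 ⟨hk, hjk, hkl⟩⟩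
  have hne : B.filter (fun z => j < z ∧ z < l) ≠ B := by
    intro h
    rw [← h] at hi
    exact absurd (Finset.mem_filter.1 hi).2.1 hij.not_gt
  refine hne (hS ?_)
  intro C hC e he e' he' hem
  obtain ⟨hCP, hCB⟩ := Finset.mem_filter.1 hC
  have he'B : p e' ∈ B := mem_fiberOver.1 (hCB he')
  obtain ⟨heB, he2, he3⟩ := Finset.mem_filter.1 hem
  refine Finset.mem_filter.2 ⟨he'B, ?_, ?_⟩
  · by_contra hlt
    have hlt' : p e' < j := lt_of_le_of_ne (not_lt.1 hlt) fun h => hd _ he'B (h ▸ hj)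
    exact key _ _ he'B heB C hCP e' he' e he rfl rfl hCB (hlt'.trans he2) j hj l hl hlt' he2
      fun h => absurd h.2 he3.not_gt
  · by_contra hlt
    have hlt' : l < p e' := lt_of_le_of_ne (not_lt.1 hlt) fun h => hd _ he'B (h ▸ hl)
    exact key _ _ heB he'B C hCP e he e' he' rfl rfl hCB (he3.trans hlt') l hl j hj he3 hlt'
      fun h => absurd h.1 he2.not_gt

/-! ### The connected components of a non-crossing partition -/

section
variable {P : Finset (Finset E)} {D : Finset α} (hP : IsNCP P (fiberOver p D))
include hP

theorem IsNCP.linked_mem_iff {k k' : α} (h : Linked p P k k') : k ∈ D ↔ k' ∈ D :=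
  h.mem_iff (D : Set α) fun C hC _ _ _ he' _ => mem_fiberOver.1 (hP.subset C hC he')

theorem connects_of_mem_componentsOf {B : Finset α} (hB : B ∈ componentsOf p P D) :
    Connects p (P.filter (· ⊆ fiberOver p B)) B := by
  obtain ⟨k, hk, hkB⟩ := mem_componentsOf.1 hB
  intro S hSB ⟨s, hs⟩ hS
  refine Finset.Subset.antisymm hSB fun x hx => ?_
  have hsx : Linked p P s x := ((hkB s).1 (hSB hs)).2.symm.trans _ _ _ ((hkB x).1 hx).2
  refine (hsx.mem_iff (S : Set α) ?_).1 hs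
  intro C hC e he e' he' heS
  refine hS C (Finset.mem_filter.2 ⟨hC, fun d hd => mem_fiberOver.2 ?_⟩) e he e' he' heS
  have h1 := (hkB (p e)).1 (hSB heS)
  have h2 : Linked p P (p e) (p d) := linked_of_mem hC he hd
  exact (hkB _).2 ⟨(hP.linked_mem_iff h2).1 h1.1, h1.2.trans _ _ _ h2⟩

theorem subset_fiberOver_of_mem_componentsOf {B : Finset α} (hB : B ∈ componentsOf p P D)
    {C : Finset E} (hC : C ∈ P) {e : E} (he : e ∈ C) (heB : p e ∈ B) : C ⊆ fiberOver p B := by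
  obtain ⟨k, hk, hkB⟩ := mem_componentsOf.1 hB
  intro d hd
  have h1 := (hkB (p e)).1 heB
  have h2 : Linked p P (p e) (p d) := linked_of_mem hC he hd
  exact mem_fiberOver.2 ((hkB _).2 ⟨(hP.linked_mem_iff h2).1 h1.1, h1.2.trans _ _ _ h2⟩)

theorem isNCP_componentsOf (hp : Monotone p) : IsNCP (componentsOf p P D) D := by
  have hdisj : ∀ B ∈ componentsOf p P D, ∀ C ∈ componentsOf p P D, ∀ e, e ∈ B → e ∈ C →
      B = C := by
    intro B hB C hC e heB heC
    obtain ⟨k, hk, hkB⟩ := mem_componentsOf.1 hB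
    obtain ⟨l, hl, hlC⟩ := mem_componentsOf.1 hC
    have hkl : Linked p P k l := ((hkB e).1 heB).2.trans _ _ _ (((hlC e).1 heC).2.symm)
    ext x
    rw [hkB, hlC]
    exact ⟨fun h => ⟨h.1, hkl.symm.trans _ _ _ h.2⟩, fun h => ⟨h.1, hkl.trans _ _ _ h.2⟩⟩
  constructor
  · intro B hB
    obtain ⟨k, hk, hkB⟩ := mem_componentsOf.1 hB
    exact ⟨k, (hkB k).2 ⟨hk, Relation.EqvGen.refl k⟩⟩
  · intro B hB x hx
    obtain ⟨k, hk, hkB⟩ := mem_componentsOf.1 hB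
    exact ((hkB x).1 hx).1
  · classical
    intro e he
    exact ⟨_, Finset.mem_image_of_mem _ he, Finset.mem_filter.2 ⟨he, Relation.EqvGen.refl e⟩⟩
  · exact hdisj
  · intro B hB C hC hne i j k l hij hjk hkl hi hk hj hl
    exact not_crossing_of_connects hp hP (fun e he he' => hne (hdisj B hB C hC e he he'))
      (connects_of_mem_componentsOf hP hB) (connects_of_mem_componentsOf hP hC)
      hij hjk hkl hi hk hj hl

theorem filter_mem_connectedNcp {B : Finset α} (hB : B ∈ componentsOf p P D) :
    P.filter (· ⊆ fiberOver p B) ∈ connectedNcp p B := by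
  refine mem_connectedNcp.2 ⟨?_, connects_of_mem_componentsOf hP hB⟩
  constructor
  · exact fun C hC => hP.nonempty C (Finset.mem_filter.1 hC).1
  · exact fun C hC => (Finset.mem_filter.1 hC).2
  · intro e he
    have heB := mem_fiberOver.1 he
    obtain ⟨k, hk, hkB⟩ := mem_componentsOf.1 hB
    obtain ⟨C, hC, heC⟩ := hP.cover e (mem_fiberOver.2 ((hkB _).1 heB).1)
    exact ⟨C, Finset.mem_filter.2
      ⟨hC, subset_fiberOver_of_mem_componentsOf hP hB hC heC heB⟩, heC⟩
  · exact fun C hC C' hC' => hP.disj C (Finset.mem_filter.1 hC).1 C' (Finset.mem_filter.1 hC').1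
  · exact fun C hC C' hC' =>
      hP.noncrossing C (Finset.mem_filter.1 hC).1 C' (Finset.mem_filter.1 hC').1

end

/-! ### Gluing connected partitions along a non-crossing partition -/

/-- The union of partitions of the sets of indices over the blocks of a partition. -/
def glue (σ : Finset (Finset α)) (q : ∀ B ∈ σ, Finset (Finset E)) : Finset (Finset E) :=
  σ.attach.biUnion fun B => q B.1 B.2

theorem mem_glue {σ : Finset (Finset α)} {q : ∀ B ∈ σ, Finset (Finset E)} {C : Finset E} :
    C ∈ glue σ q ↔ ∃ B, ∃ h : B ∈ σ, C ∈ q B h := by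
  simp [glue]

section
variable {σ : Finset (Finset α)} {D : Finset α} (hσ : IsNCP σ D)
  {q : ∀ B ∈ σ, Finset (Finset E)} (hq : ∀ B (h : B ∈ σ), q B h ∈ connectedNcp p B)
include hσ hq

theorem eq_of_mem_fiberOver_glue {B B' : Finset α} (hB : B ∈ σ) (hB' : B' ∈ σ) {C C' : Finset E}
    (hC : C ∈ q B hB) (hC' : C' ∈ q B' hB') {e : E} (he : e ∈ C) (he' : e ∈ C') : B = B' :=
  hσ.disj B hB B' hB' (p e) (mem_fiberOver.1 ((mem_connectedNcp.1 (hq B hB)).1.subset C hC he))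
    (mem_fiberOver.1 ((mem_connectedNcp.1 (hq B' hB')).1.subset C' hC' he'))

theorem isNCP_glue (hp : Monotone p) : IsNCP (glue σ q) (fiberOver p D) := by
  have hN := fun B h => (mem_connectedNcp.1 (hq B h)).1
  constructor
  · intro C hC
    obtain ⟨B, hB, hC⟩ := mem_glue.1 hC
    exact (hN B hB).nonempty C hC
  · intro C hC e he
    obtain ⟨B, hB, hC⟩ := mem_glue.1 hC
    exact mem_fiberOver.2 (hσ.subset B hB (mem_fiberOver.1 ((hN B hB).subset C hC he)))
  · intro e he
    obtain ⟨B, hB, heB⟩ := hσ.cover _ (mem_fiberOver.1 he)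
    obtain ⟨C, hC, heC⟩ := (hN B hB).cover e (mem_fiberOver.2 heB)
    exact ⟨C, mem_glue.2 ⟨B, hB, hC⟩, heC⟩
  · intro C hC C' hC' e he he'
    obtain ⟨B, hB, hC⟩ := mem_glue.1 hC
    obtain ⟨B', hB', hC'⟩ := mem_glue.1 hC'
    obtain rfl := eq_of_mem_fiberOver_glue hσ hq hB hB' hC hC' he he'
    exact (hN B hB).disj C hC C' hC' e he he'
  · intro C hC C' hC' hne i j k l hij hjk hkl hi hk hj hl
    obtain ⟨B, hB, hC⟩ := mem_glue.1 hC
    obtain ⟨B', hB', hC'⟩ := mem_glue.1 hC'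
    have m1 := fun e (he : e ∈ C) => mem_fiberOver.1 ((hN B hB).subset C hC he)
    have m2 := fun e (he : e ∈ C') => mem_fiberOver.1 ((hN B' hB').subset C' hC' he)
    by_cases hBB : B = B'
    · subst hBB
      exact (hN B hB).noncrossing C hC C' hC' hne i j k l hij hjk hkl hi hk hj hl
    -- Blocks over different members of `σ` have disjoint images, so the weak inequalities given by
    -- monotonicity are strict and the crossing descends to `σ`.
    · have hlt : ∀ e ∈ C, ∀ e' ∈ C', p e ≠ p e' := fun e he e' he' h =>
        hBB (hσ.disj B hB B' hB' (p e) (m1 e he) (h ▸ m2 e' he'))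
      exact hσ.noncrossing B hB B' hB' hBB (p i) (p j) (p k) (p l)
        (lt_of_le_of_ne (hp hij.le) (hlt i hi j hj))
        (lt_of_le_of_ne (hp hjk.le) (hlt k hk j hj).symm)
        (lt_of_le_of_ne (hp hkl.le) (hlt k hk l hl)) (m1 i hi) (m1 k hk) (m2 j hj) (m2 l hl)

theorem filter_glue {B : Finset α} (hB : B ∈ σ) :
    (glue σ q).filter (· ⊆ fiberOver p B) = q B hB := by
  have hN := fun B h => (mem_connectedNcp.1 (hq B h)).1
  ext C
  rw [Finset.mem_filter]
  constructor
  · rintro ⟨hC, hCB⟩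
    obtain ⟨B', hB', hC⟩ := mem_glue.1 hC
    obtain ⟨e, he⟩ := (hN B' hB').nonempty C hC
    obtain rfl : B = B' := hσ.disj B hB B' hB' (p e) (mem_fiberOver.1 (hCB he))
      (mem_fiberOver.1 ((hN B' hB').subset C hC he))
    exact hC
  · intro hC
    exact ⟨mem_glue.2 ⟨B, hB, hC⟩, (hN B hB).subset C hC⟩

/-- Connectedness of `q B` links all of `B`, and no link leaves `B` because each glued block lies
over a single member of `σ`. Hence the components of the glued partition give back `σ`. -/
theorem filter_linked_glue {B : Finset α} (hB : B ∈ σ) {k : α} (hk : k ∈ B) (x : α) :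
    x ∈ B ↔ x ∈ D ∧ Linked p (glue σ q) k x := by
  classical
  have hN := fun B h => (mem_connectedNcp.1 (hq B h)).1
  constructor
  · intro hx
    refine ⟨hσ.subset B hB hx, ?_⟩
    have hS := (mem_connectedNcp.1 (hq B hB)).2 (B.filter fun y => Linked p (glue σ q) k y)
      (Finset.filter_subset _ _) ⟨k, Finset.mem_filter.2 ⟨hk, Relation.EqvGen.refl k⟩⟩ ?_
    · rw [← hS] at hx
      exact (Finset.mem_filter.1 hx).2
    · intro C hC e he e' he' hm
      exact Finset.mem_filter.2 ⟨mem_fiberOver.1 ((hN B hB).subset C hC he'),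
        (Finset.mem_filter.1 hm).2.trans _ _ _
          (linked_of_mem (mem_glue.2 ⟨B, hB, hC⟩) he he')⟩
  · rintro ⟨-, hx⟩
    refine (hx.mem_iff (B : Set α) ?_).1 hk
    intro C hC e he e' he' heB
    obtain ⟨B', hB', hC⟩ := mem_glue.1 hC
    have h1 := mem_fiberOver.1 ((hN B' hB').subset C hC he)
    obtain rfl := hσ.disj B hB B' hB' _ heB h1
    exact mem_fiberOver.1 ((hN B hB).subset C hC he')

theorem componentsOf_glue : componentsOf p (glue σ q) D = σ := by
  ext B
  rw [mem_componentsOf]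
  constructor
  · rintro ⟨k, hk, h⟩
    obtain ⟨B', hB', hkB⟩ := hσ.cover k hk
    have : B = B' := by
      ext x
      rw [h, filter_linked_glue hσ hq hB' hkB]
    exact this ▸ hB'
  · intro hB
    obtain ⟨k, hk⟩ := hσ.nonempty B hB
    exact ⟨k, hσ.subset B hB hk, filter_linked_glue hσ hq hB hk⟩

end

/-- A non-crossing partition upstairs amounts to its partition `σ` into components together with a
connected partition over each block of `σ`. Taking components and restricting is inverse to gluing,
and the product of the weights factors accordingly. -/
theorem sum_ncp_fiberOver (hp : Monotone p) (K : Finset E → ℂ) (D : Finset α) :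
    ∑ P ∈ ncp (fiberOver p D), ∏ C ∈ P, K C =
      ∑ σ ∈ ncp D, ∏ B ∈ σ, ∑ P ∈ connectedNcp p B, ∏ C ∈ P, K C := by
  classical
  simp_rw [Finset.prod_sum]
  rw [Finset.sum_sigma']
  symm
  have hmem : ∀ x ∈ (ncp D).sigma fun σ => σ.pi fun B => connectedNcp (E := E) p B,
      IsNCP x.1 D ∧ ∀ B (h : B ∈ x.1), x.2 B h ∈ connectedNcp p B := by
    intro x hx
    rw [Finset.mem_sigma, mem_ncp, Finset.mem_pi] at hx
    exact hx
  refine Finset.sum_bij (fun x _ => glue x.1 x.2) ?_ ?_ ?_ ?_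
  · intro x hx
    exact mem_ncp.2 (isNCP_glue (hmem x hx).1 (hmem x hx).2 hp)
  · rintro ⟨σ, q⟩ hx ⟨σ', q'⟩ hx' h
    have h1 : IsNCP σ D ∧ ∀ B (h : B ∈ σ), q B h ∈ connectedNcp p B := hmem _ hx
    have h2 : IsNCP σ' D ∧ ∀ B (h : B ∈ σ'), q' B h ∈ connectedNcp p B := hmem _ hx'
    change glue σ q = glue σ' q' at h
    obtain rfl : σ = σ' := by
      rw [← componentsOf_glue h1.1 h1.2, ← componentsOf_glue h2.1 h2.2, h]
    congr 1
    funext B hB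
    rw [← filter_glue h1.1 h1.2 hB, ← filter_glue h2.1 h2.2 hB]
    rw [h]
  · intro P hP
    have hP' := mem_ncp.1 hP
    refine ⟨⟨componentsOf p P D, fun B _ => P.filter (· ⊆ fiberOver p B)⟩, ?_, ?_⟩
    · rw [Finset.mem_sigma, mem_ncp, Finset.mem_pi]
      exact ⟨isNCP_componentsOf hP' hp, fun B hB => filter_mem_connectedNcp hP' hB⟩
    · ext C
      rw [mem_glue]
      constructor
      · rintro ⟨B, hB, hC⟩
        exact (Finset.mem_filter.1 hC).1
      · intro hC
        obtain ⟨e, he⟩ := hP'.nonempty C hC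
        obtain ⟨B, hB, heB⟩ := (isNCP_componentsOf hP' hp).cover (p e)
          (mem_fiberOver.1 (hP'.subset C hC he))
        exact ⟨B, hB, Finset.mem_filter.2
          ⟨hC, subset_fiberOver_of_mem_componentsOf hP' hB hC he heB⟩⟩
  · intro x hx
    obtain ⟨h1, h2⟩ := hmem x hx
    rw [glue, Finset.prod_biUnion]
    intro B _ B' _ hne
    rw [Function.onFun, Finset.disjoint_left]
    intro C hC hC'
    obtain ⟨e, he⟩ := (mem_connectedNcp.1 (h2 B.1 B.2)).1.nonempty C hC
    exact hne (Subtype.ext (eq_of_mem_fiberOver_glue h1 h2 B.2 B'.2 hC hC' he he))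

end

/-! ### Ordered products over fibers and the product formula -/

section
variable {E α : Type*} [LinearOrder E] [Fintype E] [LinearOrder α] {p : E → α}

theorem orderedProd_union {A : Type*} [Ring A] {α : Type*} [LinearOrder α] (x : α → A)
    {D D' : Finset α} (h : ∀ a ∈ D, ∀ b ∈ D', a < b) :
    orderedProd x (D ∪ D') = orderedProd x D * orderedProd x D' := by
  have hd : Disjoint D D' := Finset.disjoint_left.2 fun a ha ha' => lt_irrefl a (h a ha a ha')
  have hs : (D ∪ D').sort = D.sort ++ D'.sort := by
    refine List.Perm.eq_of_pairwise (le := (· ≤ ·)) (fun a b _ _ h1 h2 => le_antisymm h1 h2)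
      (Finset.pairwise_sort _ _) ?_ ?_
    · rw [List.pairwise_append]
      refine ⟨Finset.pairwise_sort _ _, Finset.pairwise_sort _ _, fun a ha b hb => ?_⟩
      exact (h a ((Finset.mem_sort _).1 ha) b ((Finset.mem_sort _).1 hb)).le
    · rw [List.perm_ext_iff_of_nodup (Finset.sort_nodup _ _)]
      · simp
      · refine (Finset.sort_nodup _ _).append (Finset.sort_nodup _ _) fun a ha ha' => ?_
        exact Finset.disjoint_left.1 hd ((Finset.mem_sort _).1 ha) ((Finset.mem_sort _).1 ha')
  rw [orderedProd, hs, List.map_append, List.prod_append]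
  rfl

theorem orderedProd_singleton {A : Type*} [Ring A] {α : Type*} [LinearOrder α] (x : α → A)
    (a : α) : orderedProd x {a} = x a := by
  simp [orderedProd]

theorem orderedProd_fiberOver {A : Type*} [Ring A] (hp : Monotone p) (x : E → A) (D : Finset α) :
    orderedProd (fun k => orderedProd x (fiberOver p {k})) D = orderedProd x (fiberOver p D) := by
  induction D using Finset.induction_on_max with
  | empty => simp [orderedProd, fiberOver]
  | insert a s ha ih =>
    have h1 : insert a s = s ∪ {a} := by ext; simp
    have h2 : fiberOver p (s ∪ {a}) = fiberOver p s ∪ fiberOver p {a} := by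
      ext e
      simp only [mem_fiberOver, Finset.mem_union]
    rw [h1, h2, orderedProd_union, orderedProd_union, ih, orderedProd_singleton]
    · intro e he e' he'
      rw [mem_fiberOver] at he he'
      rw [Finset.mem_singleton] at he'
      exact hp.reflect_lt (he' ▸ ha _ he)
    · intro k hk b hb
      rw [Finset.mem_singleton] at hb
      exact hb ▸ ha k hk

variable {A : Type*} [Ring A] [Algebra ℂ A] (φ : A →ₗ[ℂ] ℂ)

/-- The formula for free cumulants with products as entries. -/
theorem cum_orderedProd (hφ : φ 1 = 1) (hp : Monotone p) (x : E → A) (D : Finset α)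
    (hD : D.Nonempty) :
    cum φ (fun k => orderedProd x (fiberOver p {k})) D =
      ∑ P ∈ connectedNcp p D, ∏ C ∈ P, cum φ x C := by
  -- By uniqueness it is enough that the connected sums satisfy the moment-cumulant formula; the
  -- regrouping by components is exactly this.
  refine eq_cum φ _ (fun D => ∑ P ∈ connectedNcp p D, ∏ C ∈ P, cum φ x C) (fun D hD => ?_) D hD
  rw [← sum_ncp_fiberOver hp, orderedProd_fiberOver hp]
  -- Fibers may be empty. Over an empty fiber the product is `1` and the only partition is the empty
  -- one, so the formula needs `φ 1 = 1`.
  rcases (fiberOver p D).eq_empty_or_nonempty with h | h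
  · rw [h, ncp_empty]
    simp [orderedProd, hφ]
  · exact moment_eq_sum_cum φ x _ h

end

/-! ### Multilinearity of free cumulants -/

section
variable {E : Type*} [LinearOrder E]

theorem orderedProd_congr {A : Type*} [Ring A] {x y : E → A} {D : Finset E}
    (h : ∀ e ∈ D, x e = y e) : orderedProd x D = orderedProd y D := by
  unfold orderedProd
  congr 1
  exact List.map_congr_left fun e he => h e ((Finset.mem_sort _).1 he)

theorem orderedProd_update {A : Type*} [Ring A] (x : E → A) {D : Finset E} {i : E} (hi : i ∈ D)
    (v : A) : orderedProd (Function.update x i v) D =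
      orderedProd x (D.filter (· < i)) * v * orderedProd x (D.filter (i < ·)) := by
  have hD : D = D.filter (· < i) ∪ {i} ∪ D.filter (i < ·) := by
    ext e
    simp only [Finset.mem_union, Finset.mem_filter, Finset.mem_singleton]
    rcases lt_trichotomy e i with h | h | h
    · simp [h, h.ne, h.not_gt]
    · simp [h, hi]
    · simp [h, h.ne', h.not_gt]
  conv_lhs => rw [hD]
  rw [orderedProd_union, orderedProd_union, orderedProd_singleton, Function.update_self]
  · congr 1
    · congr 1
      refine orderedProd_congr fun e he => Function.update_of_ne ?_ _ _
      exact (Finset.mem_filter.1 he).2.ne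
    · refine orderedProd_congr fun e he => Function.update_of_ne ?_ _ _
      exact (Finset.mem_filter.1 he).2.ne'
  · intro a ha b hb
    exact (Finset.mem_singleton.1 hb) ▸ (Finset.mem_filter.1 ha).2
  · intro a ha b hb
    have hb' := (Finset.mem_filter.1 hb).2
    rcases Finset.mem_union.1 ha with h | h
    · exact (Finset.mem_filter.1 h).2.trans hb'
    · exact (Finset.mem_singleton.1 h) ▸ hb'

variable {A : Type*} [Ring A] [Algebra ℂ A] (φ : A →ₗ[ℂ] ℂ)

theorem cum_congr {x y : E → A} {D : Finset E} (h : ∀ e ∈ D, x e = y e) :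
    cum φ x D = cum φ y D := by
  unfold cum
  congr 1
  funext i
  exact h _ (Finset.orderEmbOfFin_mem D rfl i)

theorem cum_eq_sub (x : E → A) (D : Finset E) (hD : D.Nonempty) :
    cum φ x D = φ (orderedProd x D) - ∑ P ∈ (ncp D).erase {D}, ∏ B ∈ P, cum φ x B := by
  rw [moment_eq_sum_cum φ x D hD, sum_ncp_eq_add hD, Finset.prod_singleton]
  ring

/-- In each partition exactly one block contains `i`. Its factor is affected by the change and, when
the partition is proper, is handled by induction on the block; the moment itself is linear in the
entry. -/
theorem cum_update_add_smul (x : E → A) (i : E) (a b : A) (c : ℂ) (D : Finset E) (hi : i ∈ D) :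
    cum φ (Function.update x i (a + c • b)) D =
      cum φ (Function.update x i a) D + c * cum φ (Function.update x i b) D := by
  induction D using Finset.strongInduction with
  | H D ih =>
    have hD : D.Nonempty := ⟨i, hi⟩
    simp only [cum_eq_sub φ _ D hD, orderedProd_update x hi]
    have hsum : ∑ P ∈ (ncp D).erase {D}, ∏ B ∈ P, cum φ (Function.update x i (a + c • b)) B =
        ∑ P ∈ (ncp D).erase {D}, ∏ B ∈ P, cum φ (Function.update x i a) B +
        c * ∑ P ∈ (ncp D).erase {D}, ∏ B ∈ P, cum φ (Function.update x i b) B := by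
      rw [Finset.mul_sum, ← Finset.sum_add_distrib]
      refine Finset.sum_congr rfl fun P hP => ?_
      have hP' := mem_ncp.1 (Finset.mem_of_mem_erase hP)
      obtain ⟨B, hB, hiB⟩ := hP'.cover i hi
      have hrest : ∀ v, ∏ C ∈ P.erase B, cum φ (Function.update x i v) C =
          ∏ C ∈ P.erase B, cum φ x C := fun v => by
        refine Finset.prod_congr rfl fun C hC => cum_congr φ fun e he => ?_
        refine Function.update_of_ne ?_ _ _
        rintro rfl
        exact (Finset.mem_erase.1 hC).1
          (hP'.disj C (Finset.mem_of_mem_erase hC) B hB e he hiB)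
      simp only [← Finset.mul_prod_erase P _ hB, hrest, ih B (IsNCP.ssubset hP hB) hiB]
      ring
    rw [hsum]
    simp only [mul_add, add_mul, mul_smul_comm, smul_mul_assoc, map_add, map_smul, smul_eq_mul]
    ring

/-- The free cumulant as a multilinear map. -/
noncomputable def cumulantMultilinear (n : ℕ) : MultilinearMap ℂ (fun _ : Fin n => A) ℂ :=
  MultilinearMap.mk' (freeCumulant φ n)
    (fun m i x y => by
      have h := cum_update_add_smul φ m i x y 1 Finset.univ (Finset.mem_univ i)
      simpa [cum_univ] using h)
    (fun m i c x => by
      -- With both entries `0` and coefficient `1`, additivity shows that a cumulant with an entry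
      -- `0` vanishes.
      have h0 := cum_update_add_smul φ m i 0 0 1 Finset.univ (Finset.mem_univ i)
      have h := cum_update_add_smul φ m i 0 x c Finset.univ (Finset.mem_univ i)
      simp only [cum_univ, one_smul, add_zero, one_mul, zero_add, left_eq_add] at h0 h
      rw [h, h0, zero_add, smul_eq_mul])

@[simp]
theorem cumulantMultilinear_apply {n : ℕ} (x : Fin n → A) :
    cumulantMultilinear φ n x = freeCumulant φ n x := rfl

/-! ### Cumulants with a constant entry -/

/-- A word without letters disconnects: a free cumulant of order at least two with an entry `1`
vanishes. -/
theorem freeCumulant_eq_zero_of_eq_one (hφ : φ 1 = 1) {n : ℕ} (x : Fin (n + 2) → A)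
    (k : Fin (n + 2)) (hk : x k = 1) : freeCumulant φ (n + 2) x = 0 := by
  -- The map `k.succAbove` misses exactly `k`, so the fiber over `k` is empty and contributes the
  -- entry `1`. No partition is connected, since `{k}` is vacuously saturated.
  have h := cum_orderedProd φ hφ (p := k.succAbove) (Fin.strictMono_succAbove k).monotone
    (fun e => x (k.succAbove e)) Finset.univ ⟨k, Finset.mem_univ k⟩
  have hx : (fun j => orderedProd (fun e => x (k.succAbove e)) (fiberOver k.succAbove {j})) = x := by
    funext j
    rcases Fin.eq_self_or_eq_succAbove k j with rfl | ⟨e, rfl⟩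
    · have : fiberOver j.succAbove {j} = ∅ := by
        ext e
        simp [mem_fiberOver, Fin.succAbove_ne]
      rw [this, hk]
      simp [orderedProd]
    · have : fiberOver k.succAbove {k.succAbove e} = {e} := by
        ext e'
        simp [mem_fiberOver]
      rw [this, orderedProd_singleton]
  rw [hx, cum_univ] at h
  rw [h]
  refine Finset.sum_eq_zero fun P hP => ?_
  exfalso
  have h1 := (mem_connectedNcp.1 hP).2 {k} (Finset.subset_univ _) (Finset.singleton_nonempty k)
    (fun C _ e _ e' _ h => absurd (Finset.mem_singleton.1 h) (Fin.succAbove_ne k e))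
  have h2 := congrArg Finset.card h1
  simp at h2

/-- In the multilinear expansion every term that contains a scalar entry vanishes. This is what
allows entries to be centered. -/
theorem freeCumulant_add_smul_one (hφ : φ 1 = 1) {n : ℕ} (x : Fin (n + 2) → A)
    (c : Fin (n + 2) → ℂ) :
    freeCumulant φ (n + 2) (fun k => x k + c k • (1 : A)) = freeCumulant φ (n + 2) x := by
  classical
  have h := (cumulantMultilinear φ (n + 2)).map_add_univ x (fun k => c k • (1 : A))
  change freeCumulant φ (n + 2) _ = _ at h
  refine h.trans ?_
  rw [Finset.sum_eq_single Finset.univ]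
  · simp
  · intro s _ hs
    obtain ⟨k, hk⟩ : ∃ k, k ∉ s := by
      by_contra hcon
      push Not at hcon
      exact hs (Finset.eq_univ_iff_forall.2 hcon)
    have h1 : s.piecewise x (fun k => c k • (1 : A)) =
        Function.update (s.piecewise x (fun k => c k • (1 : A))) k (c k • (1 : A)) := by
      rw [Function.update_eq_self_iff.2]
      simp [hk]
    rw [h1, MultilinearMap.map_update_smul, cumulantMultilinear_apply,
      freeCumulant_eq_zero_of_eq_one φ hφ _ k (Function.update_self _ _ _), smul_zero]
  · simp

end

/-! ### Vanishing of mixed free cumulants -/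

/-- A non-crossing partition without singletons has a block with two adjacent elements. -/
theorem IsNCP.exists_adjacent {n : ℕ} {P : Finset (Finset (Fin n))}
    (hP : IsNCP P Finset.univ) (hn : 0 < n) (hcard : ∀ B ∈ P, B.card ≠ 1) :
    ∃ B ∈ P, ∃ j ∈ B, ∃ k ∈ B, (k : ℕ) = j + 1 := by
  have hother : ∀ B ∈ P, ∀ i ∈ B, ∃ j ∈ B, j ≠ i := fun B hB i hi => by
    have h1 : 0 < B.card := Finset.card_pos.2 ⟨i, hi⟩
    have h2 := hcard B hB
    exact Finset.exists_mem_ne (by omega) i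
  have key : ∀ d : ℕ, ∀ B ∈ P, ∀ i ∈ B, ∀ j ∈ B, i < j → (j : ℕ) - i ≤ d →
      ∃ B ∈ P, ∃ j ∈ B, ∃ k ∈ B, (k : ℕ) = j + 1 := by
    intro d
    induction d with
    | zero =>
      intro B hB i hi j hj hij h
      have := Fin.lt_def.1 hij
      omega
    | succ d ih =>
      intro B hB i hi j hj hij h
      have hij' := Fin.lt_def.1 hij
      by_cases hadj : (j : ℕ) = i + 1
      · exact ⟨B, hB, i, hi, j, hj, hadj⟩
      -- The right neighbour of `i` lies in another block, and non-crossing confines that whole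
      -- block to the open interval from `i` to `j`. A second element of it gives a strictly shorter
      -- arc.
      let m : Fin n := ⟨i + 1, by omega⟩
      obtain ⟨C, hC, hm⟩ := hP.cover m (Finset.mem_univ m)
      by_cases hBC : B = C
      · exact ⟨B, hB, i, hi, m, hBC ▸ hm, rfl⟩
      obtain ⟨m', hm', hne⟩ := hother C hC m hm
      have him : i < m := Fin.lt_def.2 (Nat.lt_succ_self _)
      have hmj : m < j := Fin.lt_def.2 (show (i : ℕ) + 1 < j by omega)
      have h1 : ¬ m' < i := fun h => hP.noncrossing C hC B hB (Ne.symm hBC) m' i m j h him hmj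
        hm' hm hi hj
      have h2 : ¬ j < m' := fun h => hP.noncrossing B hB C hC hBC i m j m' him hmj h hi hj hm hm'
      have h3 : m' ≠ i := fun h => hBC (hP.disj B hB C hC i hi (h ▸ hm'))
      have h4 : m' ≠ j := fun h => hBC (hP.disj B hB C hC j hj (h ▸ hm'))
      have hval : (m : ℕ) = i + 1 := rfl
      have h5 : (m' : ℕ) ≠ m := fun h => hne (Fin.ext h)
      have h6 : (m' : ℕ) ≠ i := fun h => h3 (Fin.ext h)
      have h7 : (m' : ℕ) ≠ j := fun h => h4 (Fin.ext h)
      rw [Fin.lt_def] at h1 h2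
      exact ih C hC m hm m' hm' (Fin.lt_def.2 (by omega)) (by omega)
  obtain ⟨B, hB, hi⟩ := hP.cover ⟨0, hn⟩ (Finset.mem_univ _)
  obtain ⟨j, hj, hne⟩ := hother B hB _ hi
  exact key _ B hB _ hi j hj (Fin.lt_def.2 (Nat.pos_of_ne_zero fun h => hne (Fin.ext h))) le_rfl

section
variable {A : Type*} [Ring A] [Algebra ℂ A] (φ : A →ₗ[ℂ] ℂ)

theorem orderedProd_univ {n : ℕ} (x : Fin n → A) :
    orderedProd x Finset.univ = (List.ofFn x).prod := by
  rw [orderedProd, Fin.sort_univ, List.ofFn_eq_map]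

theorem orderedProd_mem {E : Type*} [LinearOrder E] (x : E → A) (D : Finset E)
    (R : Subalgebra ℂ A) (h : ∀ e ∈ D, x e ∈ R) : orderedProd x D ∈ R := by
  refine R.list_prod_mem fun y hy => ?_
  obtain ⟨e, he, rfl⟩ := List.mem_map.1 hy
  exact h e ((Finset.mem_sort _).1 he)

theorem cum_eq_zero_of_mixed {ι : Type*} {𝒜 : ι → Subalgebra ℂ A} {n : ℕ}
    (ih : ∀ m < n, ∀ (c : Fin m → ι) (a : Fin m → A), (∀ k, a k ∈ 𝒜 (c k)) →
      (∃ j k, c j ≠ c k) → freeCumulant φ m a = 0)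
    (c : Fin n → ι) (a : Fin n → A) (ha : ∀ k, a k ∈ 𝒜 (c k)) (B : Finset (Fin n))
    (hB : B ⊂ Finset.univ) (hc : ∃ j ∈ B, ∃ k ∈ B, c j ≠ c k) : cum φ a B = 0 := by
  obtain ⟨j, hj, k, hk, hjk⟩ := hc
  rw [← Finset.mem_coe, ← Finset.range_orderEmbOfFin B rfl] at hj hk
  obtain ⟨j, rfl⟩ := hj
  obtain ⟨k, rfl⟩ := hk
  refine ih B.card ?_ (fun i => c (B.orderEmbOfFin rfl i)) _ (fun i => ha _) ⟨j, k, hjk⟩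
  simpa using Finset.card_lt_card hB

variable {φ}

/-- Mixed free cumulants of elements of free subalgebras vanish. -/
theorem AreFree.freeCumulant_eq_zero {ι : Type*} {𝒜 : ι → Subalgebra ℂ A} (h𝒜 : AreFree φ 𝒜)
    (hφ : φ 1 = 1) (n : ℕ) (c : Fin n → ι) (a : Fin n → A) (ha : ∀ k, a k ∈ 𝒜 (c k))
    (hc : ∃ j k, c j ≠ c k) : freeCumulant φ n a = 0 := by
  induction n using Nat.strong_induction_on with
  | _ n ih =>
    by_cases halt : ∀ j k : Fin n, (k : ℕ) = j + 1 → c j ≠ c k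
    · obtain ⟨j₀, k₀, hjk⟩ := hc
      have hn : 2 ≤ n := by
        have h1 := j₀.2
        have h2 := k₀.2
        by_contra hlt
        exact hjk (congrArg c (Fin.ext (by omega)))
      obtain ⟨m, rfl⟩ : ∃ m, n = m + 2 := ⟨n - 2, by omega⟩
      -- Alternating case: centering does not change the cumulant, and freeness makes the moment of
      -- the centered elements vanish.
      let b : Fin (m + 2) → A := fun k => a k + (-φ (a k)) • (1 : A)
      have hb0 : ∀ k, φ (b k) = 0 := fun k => by simp [b, hφ]
      have hb : ∀ k, b k ∈ 𝒜 (c k) := fun k =>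
        add_mem (ha k) ((𝒜 (c k)).smul_mem (one_mem _) _)
      rw [← freeCumulant_add_smul_one φ hφ a fun k => -φ (a k)]
      change freeCumulant φ (m + 2) b = 0
      rw [← cum_univ, cum_eq_sub φ b _ ⟨0, Finset.mem_univ _⟩, orderedProd_univ,
        h𝒜 (m + 2) c b (by omega) hb hb0 halt, zero_sub, neg_eq_zero]
      -- A proper partition has a singleton, whose cumulant is `0` by centering, or a block with two
      -- adjacent elements, which is mixed and vanishes by induction.
      refine Finset.sum_eq_zero fun P hP => ?_
      by_contra hne
      rw [Finset.prod_eq_zero_iff] at hne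
      push Not at hne
      obtain ⟨B, hB, j, hj, k, hk, hadj⟩ :=
        (mem_ncp.1 (Finset.mem_of_mem_erase hP)).exists_adjacent (by omega) (by
          intro B hB h1
          obtain ⟨e, rfl⟩ := Finset.card_eq_one.1 h1
          exact hne _ hB ((cum_singleton φ b e).trans (hb0 e)))
      exact hne B hB (cum_eq_zero_of_mixed φ ih c b hb B (IsNCP.ssubset hP hB)
        ⟨j, hj, k, hk, halt j k hadj⟩)
    -- Two neighbours lie in the same subalgebra. Merging them into their product gives a cumulant
    -- of order one less that is still mixed, hence `0` by induction; the product formula writes it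
    -- as the desired cumulant plus terms of other connected partitions.
    · push Not at halt
      obtain ⟨j, k, hjk, hcjk⟩ := halt
      obtain ⟨m, rfl⟩ : ∃ m, n = m + 1 := ⟨n - 1, by have := j.2; omega⟩
      let i : Fin m := ⟨j, by have := k.2; omega⟩
      have hij : i.castSucc = j := rfl
      have hik : i.succ = k := Fin.ext hjk.symm
      let p : Fin (m + 1) → Fin m := i.predAbove
      let c' : Fin m → ι := fun t => c (i.castSucc.succAbove t)
      have hc' : ∀ e, c' (p e) = c e := fun e => by
        by_cases he : e = i.castSucc
        · subst he
          simp only [c', p, Fin.predAbove_castSucc_self, Fin.succAbove_castSucc_self]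
          rw [hik, hij, hcjk]
        · simp only [c', p, Fin.succAbove_predAbove he]
      have hp : Monotone p := Fin.predAbove_right_monotone i
      have hps : ∀ t, p (i.castSucc.succAbove t) = t := fun t => Fin.predAbove_succAbove i t
      obtain ⟨j₀, k₀, hjk₀⟩ := hc
      have hX := ih m (Nat.lt_succ_self m) c' (fun t => orderedProd a (fiberOver p {t}))
        (fun t => orderedProd_mem _ _ _ fun e he => by
          rw [mem_fiberOver, Finset.mem_singleton] at he
          rw [← he, hc']
          exact ha e) ⟨p j₀, p k₀, by rwa [hc', hc']⟩
      rw [← cum_univ, cum_orderedProd φ hφ hp a _ ⟨i, Finset.mem_univ i⟩] at hX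
      have huniv : fiberOver p (Finset.univ : Finset (Fin m)) = Finset.univ := by
        ext e
        simp [mem_fiberOver]
      rw [Finset.sum_eq_single {Finset.univ}] at hX
      · simpa [cum_univ] using hX
      · intro P hP hne
        obtain ⟨hP1, hP2⟩ := mem_connectedNcp.1 hP
        rw [huniv] at hP1
        by_contra h0
        rw [Finset.prod_eq_zero_iff] at h0
        push Not at h0
        have hmono : ∀ C ∈ P, ∀ e ∈ C, ∀ e' ∈ C, c e = c e' := by
          intro C hC e he e' he'
          by_contra hee
          exact h0 C hC (cum_eq_zero_of_mixed φ ih c a ha C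
            (IsNCP.ssubset (Finset.mem_erase.2 ⟨hne, mem_ncp.2 hP1⟩) hC) ⟨e, he, e', he', hee⟩)
        -- For a non-zero term all blocks are monochromatic, so the positions with the colour of
        -- `j₀` form a saturated set. It omits `p k₀`, contradicting connectedness.
        classical
        have hS := hP2 (Finset.univ.filter fun t => c' t = c j₀) (Finset.subset_univ _)
          ⟨p j₀, by simp [hc']⟩ (by
            intro C hC e he e' he' hm
            rw [Finset.mem_filter, hc'] at hm ⊢
            exact ⟨Finset.mem_univ _, (hmono C hC e' he' e he).trans hm.2⟩)
        have := hS ▸ Finset.mem_univ (p k₀)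
        rw [Finset.mem_filter, hc'] at this
        exact hjk₀ this.2.symm
      · intro h
        refine absurd (mem_connectedNcp.2 ⟨?_, ?_⟩) h
        · rw [huniv]
          exact isNCP_singleton ⟨j, Finset.mem_univ j⟩
        · intro S _ ⟨s, hs⟩ hS
          refine Finset.eq_univ_iff_forall.2 fun t => ?_
          have := hS Finset.univ (Finset.mem_singleton_self _) (i.castSucc.succAbove s)
            (Finset.mem_univ _) (i.castSucc.succAbove t) (Finset.mem_univ _)
          rw [hps, hps] at this
          exact this hs

end

/-! ### Free cumulants of the entries of a semicircular ensemble -/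

/-- A multilinear map whose values on tuples from given sets lie in a submodule has its values on
tuples from the spans in that submodule. -/
theorem multilinear_mem_of_span {R ι V M : Type*} [CommRing R] [Fintype ι]
    [AddCommGroup V] [Module R V] [AddCommGroup M] [Module R M]
    (F : MultilinearMap R (fun _ : ι => V) M) (W : Submodule R M) (s : ι → Set V)
    (h : ∀ x : ι → V, (∀ k, x k ∈ s k) → F x ∈ W) (x : ι → V)
    (hx : ∀ k, x k ∈ Submodule.span R (s k)) : F x ∈ W := by
  classical
  have key : ∀ T : Finset ι, ∀ x : ι → V, (∀ k ∈ T, x k ∈ Submodule.span R (s k)) →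
      (∀ k ∉ T, x k ∈ s k) → F x ∈ W := by
    intro T
    induction T using Finset.induction_on with
    | empty => exact fun x _ hx => h x fun k => hx k (Finset.notMem_empty k)
    | insert k T hk ih =>
      intro x h1 h2
      suffices hw : ∀ w ∈ Submodule.span R (s k), F (Function.update x k w) ∈ W by
        rw [← Function.update_eq_self k x]
        exact hw _ (h1 k (Finset.mem_insert_self k T))
      intro w hxk
      induction hxk using Submodule.span_induction with
      | mem v hv =>
        refine ih _ (fun l hl => ?_) fun l hl => ?_
        · have hlk : l ≠ k := fun h => hk (h ▸ hl)
          rw [Function.update_of_ne hlk]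
          exact h1 l (Finset.mem_insert_of_mem hl)
        · by_cases hlk : l = k
          · subst hlk
            rwa [Function.update_self]
          · rw [Function.update_of_ne hlk]
            exact h2 l fun hm => (Finset.mem_insert.1 hm).elim hlk hl
      | zero => simp
      | add v w _ _ hv hw =>
        rw [MultilinearMap.map_update_add]
        exact W.add_mem hv hw
      | smul c v _ hv =>
        rw [MultilinearMap.map_update_smul]
        exact W.smul_mem c hv
  exact key Finset.univ x (fun k _ => hx k) fun k hk => absurd (Finset.mem_univ k) hk

/-- Finitely many vectors of a complexification lie in the complex span of a finite orthonormal
family of real vectors. -/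
theorem exists_orthonormal_span {H : Type*} [NormedAddCommGroup H] [InnerProductSpace ℝ H]
    {κ : Type*} [Finite κ] (f : κ → ℂ ⊗[ℝ] H) :
    ∃ (p : ℕ) (e : Fin p → H), Orthonormal ℝ e ∧
      ∀ k, f k ∈ Submodule.span ℂ (Set.range fun q => (1 : ℂ) ⊗ₜ[ℝ] e q) := by
  classical
  have h1 : ∀ g : ℂ ⊗[ℝ] H, ∃ t : Set H, t.Finite ∧
      g ∈ Submodule.span ℂ ((fun h => (1 : ℂ) ⊗ₜ[ℝ] h) '' t) := by
    intro g
    induction g using TensorProduct.induction_on with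
    | zero => exact ⟨∅, Set.finite_empty, zero_mem _⟩
    | tmul z h =>
      refine ⟨{h}, Set.finite_singleton h, ?_⟩
      have : z ⊗ₜ[ℝ] h = z • ((1 : ℂ) ⊗ₜ[ℝ] h) := by
        rw [TensorProduct.smul_tmul', smul_eq_mul, mul_one]
      rw [this]
      exact Submodule.smul_mem _ _ (Submodule.subset_span ⟨h, rfl, rfl⟩)
    | add g g' ih ih' =>
      obtain ⟨t, ht, hg⟩ := ih
      obtain ⟨t', ht', hg'⟩ := ih'
      refine ⟨t ∪ t', ht.union ht', Submodule.add_mem _ ?_ ?_⟩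
      · exact Submodule.span_mono (Set.image_mono Set.subset_union_left) hg
      · exact Submodule.span_mono (Set.image_mono Set.subset_union_right) hg'
  choose t ht hft using fun k => h1 (f k)
  let V : Submodule ℝ H := Submodule.span ℝ (⋃ k, t k)
  have : FiniteDimensional ℝ V :=
    FiniteDimensional.span_of_finite ℝ (Set.finite_iUnion ht)
  let b := stdOrthonormalBasis ℝ V
  refine ⟨Module.finrank ℝ V, fun q => (b q : H), b.orthonormal.comp_linearIsometry V.subtypeₗᵢ,
    fun k => ?_⟩
  refine Submodule.span_le.2 ?_ (hft k)
  rintro _ ⟨h, hh, rfl⟩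
  have hV : h ∈ V := Submodule.subset_span (Set.mem_iUnion.2 ⟨k, hh⟩)
  have hsum : h = ∑ q, (b.repr ⟨h, hV⟩ q) • (b q : H) := by
    have := congrArg (Subtype.val) (b.sum_repr ⟨h, hV⟩)
    simpa using this.symm
  change (1 : ℂ) ⊗ₜ[ℝ] h ∈ _
  rw [hsum, TensorProduct.tmul_sum]
  refine Submodule.sum_mem _ fun q _ => ?_
  have : (1 : ℂ) ⊗ₜ[ℝ] ((b.repr ⟨h, hV⟩ q) • (b q : H)) =
      ((b.repr ⟨h, hV⟩ q : ℝ) : ℂ) • ((1 : ℂ) ⊗ₜ[ℝ] (b q : H)) := by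
    rw [TensorProduct.tmul_smul, TensorProduct.smul_tmul', TensorProduct.smul_tmul',
      Complex.real_smul, smul_eq_mul]
  rw [this]
  exact Submodule.smul_mem _ _ (Submodule.subset_span ⟨q, rfl⟩)

section
variable {A : Type*} [CStarAlgebra A] {φ : A →ₗ[ℂ] ℂ}
  {H : Type*} [NormedAddCommGroup H] [InnerProductSpace ℝ H]
  {S : (N : ℕ) → (ℂ ⊗[ℝ] H) →ₗ[ℂ] Matrix (Fin N) (Fin N) A}

/-- Freeness is assumed only on and above the diagonal. By self-adjointness the entries below are
adjoints of entries above, hence combinations of the same real and imaginary parts. -/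
theorem IsSemicircularEnsemble.entry_mem_span (hS : IsSemicircularEnsemble φ S) {N p : ℕ}
    (e : Fin p → H) (f : ℂ ⊗[ℝ] H)
    (hf : f ∈ Submodule.span ℂ (Set.range fun q => (1 : ℂ) ⊗ₜ[ℝ] e q)) (i j : Fin N) :
    S N f i j ∈ Submodule.span ℂ (Set.range
      fun x : Fin p × {q : Fin N × Fin N // q.1 ≤ q.2} × Bool =>
        reIm x.2.2 (S N ((1 : ℂ) ⊗ₜ[ℝ] e x.1) x.2.1.1.1 x.2.1.1.2)) := by
  induction hf using Submodule.span_induction with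
  | mem f hf =>
    obtain ⟨q, rfl⟩ := hf
    have key : ∀ i j : Fin N, ∀ h : i ≤ j, ∀ b : Bool,
        reIm b (S N ((1 : ℂ) ⊗ₜ[ℝ] e q) i j) ∈ Submodule.span ℂ (Set.range
          fun x : Fin p × {q : Fin N × Fin N // q.1 ≤ q.2} × Bool =>
            reIm x.2.2 (S N ((1 : ℂ) ⊗ₜ[ℝ] e x.1) x.2.1.1.1 x.2.1.1.2)) :=
      fun i j h b => Submodule.subset_span ⟨(q, ⟨(i, j), h⟩, b), rfl⟩
    rcases le_total i j with h | h
    · have h1 := realPart_add_I_smul_imaginaryPart (S N ((1 : ℂ) ⊗ₜ[ℝ] e q) i j)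
      change S N ((1 : ℂ) ⊗ₜ[ℝ] e q) i j ∈ _
      rw [← h1]
      exact Submodule.add_mem _ (key i j h true) (Submodule.smul_mem _ _ (key i j h false))
    · have hsa : S N ((1 : ℂ) ⊗ₜ[ℝ] e q) i j = star (S N ((1 : ℂ) ⊗ₜ[ℝ] e q) j i) := by
        have := congrFun (congrFun (hS.selfAdjoint N (e q)) i) j
        exact this.symm
      have h1 := realPart_add_I_smul_imaginaryPart (S N ((1 : ℂ) ⊗ₜ[ℝ] e q) j i)
      change S N ((1 : ℂ) ⊗ₜ[ℝ] e q) i j ∈ _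
      rw [hsa, ← h1, star_add, star_smul, selfAdjoint.star_val_eq, selfAdjoint.star_val_eq]
      exact Submodule.add_mem _ (key j i h true) (Submodule.smul_mem _ _ (key j i h false))
  | zero => simp
  | add f g _ _ hf hg =>
    rw [map_add]
    exact Submodule.add_mem _ hf hg
  | smul c f _ hf =>
    rw [map_smul]
    exact Submodule.smul_mem _ c hf

/-- The free cumulants of order different from two of the entries vanish. -/
theorem IsSemicircularEnsemble.freeCumulant_entries (hS : IsSemicircularEnsemble φ S)
    (hφ : φ 1 = 1) {N n : ℕ} (hn : 1 ≤ n) (hn2 : n ≠ 2) (f : Fin n → ℂ ⊗[ℝ] H)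
    (i j : Fin n → Fin N) : freeCumulant φ n (fun k => S N (f k) (i k) (j k)) = 0 := by
  obtain ⟨p, e, he, hf⟩ := exists_orthonormal_span f
  have hmem := fun k => hS.entry_mem_span e (f k) (hf k) (i k) (j k)
  refine (Submodule.mem_bot ℂ).1 (multilinear_mem_of_span (cumulantMultilinear φ n) ⊥ _
    (fun x hx => (Submodule.mem_bot ℂ).2 ?_) _ hmem)
  choose c hc using hx
  obtain rfl := funext hc
  -- On generators a cumulant is either mixed, and vanishes by freeness, or has all entries equal to
  -- one semicircular element.
  by_cases hconst : ∃ k l, c k ≠ c l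
  · exact (hS.free N p e he).freeCumulant_eq_zero hφ n c _
      (fun k => Algebra.subset_adjoin rfl) hconst
  · push Not at hconst
    obtain ⟨v, hv⟩ := hS.semicircular N (e (c ⟨0, hn⟩).1) (c ⟨0, hn⟩).2.1.1.1
      (c ⟨0, hn⟩).2.1.1.2 (c ⟨0, hn⟩).2.2
    have := hv.2.2 n hn
    rw [if_neg hn2] at this
    rw [cumulantMultilinear_apply, ← this]
    congr 1
    funext k
    rw [hconst k ⟨0, hn⟩]

end

/-! ### Second cumulants of centered elements -/

section
variable {A : Type*} [Ring A] [Algebra ℂ A] (φ : A →ₗ[ℂ] ℂ) {E : Type*} [LinearOrder E]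

theorem orderedProd_pair {A : Type*} [Ring A] (x : E → A) {e e' : E} (h : e < e') :
    orderedProd x {e, e'} = x e * x e' := by
  have h1 : ({e, e'} : Finset E) = {e} ∪ {e'} := rfl
  rw [h1, orderedProd_union, orderedProd_singleton, orderedProd_singleton]
  intro a ha b hb
  rw [Finset.mem_singleton] at ha hb
  rwa [ha, hb]

/-- The second free cumulant of centered elements. -/
theorem cum_pair (x : E → A) (hx : ∀ e, φ (x e) = 0) {e e' : E} (h : e < e') :
    cum φ x {e, e'} = φ (x e * x e') := by
  rw [cum_eq_sub φ x _ ⟨e, by simp⟩, orderedProd_pair x h, sub_eq_self]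
  refine Finset.sum_eq_zero fun P hP => ?_
  obtain ⟨B, hB, heB⟩ := (mem_ncp.1 (Finset.mem_of_mem_erase hP)).cover e (by simp)
  have h1 := Finset.card_lt_card (IsNCP.ssubset hP hB)
  rw [Finset.card_pair h.ne] at h1
  have h2 : 0 < B.card := Finset.card_pos.2 ⟨e, heB⟩
  obtain ⟨d, rfl⟩ := Finset.card_eq_one.1 (show B.card = 1 by omega)
  exact Finset.prod_eq_zero hB ((cum_singleton φ x d).trans (hx d))

end

/-! ### The Euler bound for numbers of cycles -/

section
variable {E : Type*} [Finite E]

/-- The number of classes of an equivalence relation. -/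
noncomputable def numClasses (r : Setoid E) : ℕ := Nat.card (Quotient r)

theorem numClasses_le_of_le {r s : Setoid E} (h : r ≤ s) : numClasses s ≤ numClasses r := by
  refine Nat.card_le_card_of_surjective (Quotient.map' id fun a b hab => h hab) ?_
  rintro ⟨a⟩
  exact ⟨Quotient.mk r a, rfl⟩

theorem numClasses_lt_of_le {r s : Setoid E} (h : r ≤ s) {a b : E} (hs : s a b) (hr : ¬ r a b) :
    numClasses s + 1 ≤ numClasses r := by
  by_contra hcon
  have heq : numClasses r = numClasses s :=
    le_antisymm (by omega) (numClasses_le_of_le h)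
  let F : Quotient r → Quotient s := Quotient.map' id fun a b hab => h hab
  have hF : Function.Surjective F := by
    rintro ⟨a⟩
    exact ⟨Quotient.mk r a, rfl⟩
  have hinj := ((Nat.bijective_iff_surjective_and_card F).2 ⟨hF, heq⟩).1
  exact hr (Quotient.exact (hinj (Quotient.sound hs : F (Quotient.mk r a) = F (Quotient.mk r b))))

/-- The equivalence relation obtained by joining the classes of `a` and `b`. -/
def joinPair (r : Setoid E) (a b : E) : Setoid E where
  r x y := r x y ∨ ((r x a ∨ r x b) ∧ (r y a ∨ r y b))
  iseqv := by
    refine ⟨fun x => Or.inl (r.refl x), ?_, ?_⟩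
    · rintro x y (h | ⟨h, h'⟩)
      · exact Or.inl (r.symm h)
      · exact Or.inr ⟨h', h⟩
    · rintro x y z (h | ⟨h, h'⟩) (k | ⟨k, k'⟩)
      · exact Or.inl (r.trans h k)
      · exact Or.inr ⟨k.imp (r.trans h) (r.trans h), k'⟩
      · exact Or.inr ⟨h, h'.imp (r.trans (r.symm k)) (r.trans (r.symm k))⟩
      · exact Or.inr ⟨h, k'⟩

theorem le_joinPair (r : Setoid E) (a b : E) : r ≤ joinPair r a b := fun _ _ h => Or.inl h

theorem joinPair_pair (r : Setoid E) (a b : E) : joinPair r a b a b :=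
  Or.inr ⟨Or.inl (r.refl a), Or.inr (r.refl b)⟩

theorem joinPair_le {r s : Setoid E} {a b : E} (h : r ≤ s) (hab : s a b) : joinPair r a b ≤ s := by
  have h1 : ∀ z, r z a ∨ r z b → s z a := fun z hz =>
    hz.elim (fun h' => h h') fun h' => s.trans (h h') (s.symm hab)
  rintro x y (hxy | ⟨hx, hy⟩)
  · exact h hxy
  · exact s.trans (h1 x hx) (s.symm (h1 y hy))

theorem numClasses_le_joinPair_add_one (r : Setoid E) (a b : E) :
    numClasses r ≤ numClasses (joinPair r a b) + 1 := by
  classical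
  -- The class of `b` goes to `none` and every other class to its image; after removing one of the
  -- two joined classes nothing is identified.
  let F : Quotient r → Option (Quotient (joinPair r a b)) :=
    Quotient.lift (fun x => if r x b then none else some (Quotient.mk (joinPair r a b) x)) (by
      intro x y hxy
      by_cases hx : r x b
      · have hy : r y b := r.trans (r.symm hxy) hx
        simp only [hx, hy, if_true]
      · have hy : ¬ r y b := fun hy => hx (r.trans hxy hy)
        simp only [hx, hy, if_false]
        exact congrArg some (Quotient.sound (Or.inl hxy)))
  have hF : Function.Injective F := by
    rintro ⟨x⟩ ⟨y⟩ h
    change (if r x b then none else some (Quotient.mk (joinPair r a b) x)) =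
      (if r y b then none else some (Quotient.mk (joinPair r a b) y)) at h
    refine Quotient.sound ?_
    by_cases hx : r x b <;> by_cases hy : r y b
    · exact r.trans hx (r.symm hy)
    · simp [hx, hy] at h
    · simp [hx, hy] at h
    · simp only [hx, hy, if_false, Option.some.injEq] at h
      rcases Quotient.exact h with h' | ⟨h1, h2⟩
      · exact h'
      · exact r.trans (h1.resolve_right hx) (r.symm (h2.resolve_right hy))
  have := Nat.card_le_card_of_injective F hF
  rwa [Finite.card_option] at this

end

/-! ### Cycles of a permutation multiplied by transpositions -/

section
variable {E : Type*} [Finite E] [DecidableEq E]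

theorem sameCycle_le_of_forall {τ : Equiv.Perm E} {r : Setoid E} (h : ∀ x, r x (τ x)) :
    Equiv.Perm.SameCycle.setoid τ ≤ r := by
  rintro x y hxy
  obtain ⟨n, rfl⟩ := (Equiv.Perm.SameCycle.exists_nat_pow_eq hxy : ∃ n : ℕ, (τ ^ n) x = y)
  induction n with
  | zero => exact r.refl x
  | succ n ih =>
    rw [pow_succ', Equiv.Perm.mul_apply]
    exact r.trans (ih ⟨n, by simp⟩) (h _)

/-- Once `a` and `b` are identified the transposition has no visible effect: each step of `τ` is a
step of `τ * swap a b`, preceded if necessary by an exchange of `a` and `b`. -/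
theorem joinPair_sameCycle_le (τ : Equiv.Perm E) (a b : E) :
    joinPair (Equiv.Perm.SameCycle.setoid τ) a b ≤
      joinPair (Equiv.Perm.SameCycle.setoid (τ * Equiv.swap a b)) a b := by
  set J := joinPair (Equiv.Perm.SameCycle.setoid (τ * Equiv.swap a b)) a b with hJ
  have hstep : ∀ x, J x ((τ * Equiv.swap a b) x) := fun x =>
    le_joinPair _ a b (show Equiv.Perm.SameCycle _ x _ from ⟨1, by simp⟩)
  refine joinPair_le (sameCycle_le_of_forall fun x => ?_) (joinPair_pair _ a b)
  by_cases hxa : x = a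
  · subst hxa
    refine J.trans (joinPair_pair _ x b) ?_
    simpa using hstep b
  · by_cases hxb : x = b
    · subst hxb
      refine J.trans (J.symm (joinPair_pair _ a x)) ?_
      simpa using hstep a
    · simpa [Equiv.swap_apply_of_ne_of_ne hxa hxb] using hstep x

theorem numClasses_joinPair_mul_swap (τ : Equiv.Perm E) (a b : E) :
    numClasses (joinPair (Equiv.Perm.SameCycle.setoid (τ * Equiv.swap a b)) a b) ≤
      numClasses (joinPair (Equiv.Perm.SameCycle.setoid τ) a b) :=
  numClasses_le_of_le (joinPair_sameCycle_le τ a b)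

/-- Multiplication by a transposition adds at most one cycle. -/
theorem numClasses_mul_swap_le (τ : Equiv.Perm E) (a b : E) :
    numClasses (Equiv.Perm.SameCycle.setoid (τ * Equiv.swap a b)) ≤
      numClasses (Equiv.Perm.SameCycle.setoid τ) + 1 :=
  (numClasses_le_joinPair_add_one _ a b).trans (Nat.add_le_add_right
    ((numClasses_joinPair_mul_swap τ a b).trans (numClasses_le_of_le (le_joinPair _ a b))) 1)

/-- Multiplication by a transposition of elements of different cycles joins the two cycles. -/
theorem sameCycle_mul_swap {τ : Equiv.Perm E} {a b : E} (h : ¬ τ.SameCycle a b) :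
    (τ * Equiv.swap a b).SameCycle a b := by
  have hex : ∃ k : ℕ, (τ ^ (k + 1)) b = b := by
    refine ⟨orderOf τ - 1, ?_⟩
    have h1 : 0 < orderOf τ := orderOf_pos τ
    rw [Nat.sub_add_cancel h1, pow_orderOf_eq_one, Equiv.Perm.one_apply]
  classical
  have hk := Nat.find_spec hex
  have hmin : ∀ m < Nat.find hex, (τ ^ (m + 1)) b ≠ b := fun m hm => Nat.find_min hex hm
  -- From `a` the product jumps onto the `τ`-cycle of `b` and follows it. It meets neither `a`,
  -- which is in another cycle, nor `b` before the first return, so it arrives at `b`.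
  have key : ∀ m ≤ Nat.find hex, ((τ * Equiv.swap a b) ^ (m + 1)) a = (τ ^ (m + 1)) b := by
    intro m
    induction m with
    | zero => simp
    | succ m ih =>
      intro hm
      rw [pow_succ', Equiv.Perm.mul_apply, ih (by omega), Equiv.Perm.mul_apply,
        Equiv.swap_apply_of_ne_of_ne, ← Equiv.Perm.mul_apply, ← pow_succ']
      · intro heq
        exact h (Equiv.Perm.SameCycle.symm ⟨((m + 1 : ℕ) : ℤ), by rw [zpow_natCast, heq]⟩)
      · exact hmin m (by omega)
  refine ⟨((Nat.find hex + 1 : ℕ) : ℤ), ?_⟩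
  rw [zpow_natCast, key _ le_rfl, hk]

theorem numClasses_mul_swap_lt {τ : Equiv.Perm E} {a b : E} (h : ¬ τ.SameCycle a b) :
    numClasses (Equiv.Perm.SameCycle.setoid (τ * Equiv.swap a b)) + 1 ≤
      numClasses (Equiv.Perm.SameCycle.setoid τ) := by
  have h1 : numClasses (Equiv.Perm.SameCycle.setoid (τ * Equiv.swap a b)) ≤
      numClasses (joinPair (Equiv.Perm.SameCycle.setoid (τ * Equiv.swap a b)) a b) :=
    numClasses_le_of_le (joinPair_le le_rfl (sameCycle_mul_swap h))
  have h2 := numClasses_lt_of_le (le_joinPair (Equiv.Perm.SameCycle.setoid τ) a b)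
    (joinPair_pair _ a b) h
  exact (Nat.add_le_add_right (h1.trans (numClasses_joinPair_mul_swap τ a b)) 1).trans h2

/-- The equivalence relation generated by two permutations. -/
def generated (γ s : Equiv.Perm E) : Setoid E :=
  Relation.EqvGen.setoid fun x y => y = γ x ∨ y = s x

theorem generated_le_iff {γ s : Equiv.Perm E} {r : Setoid E} :
    generated γ s ≤ r ↔ ∀ x, r x (γ x) ∧ r x (s x) := by
  constructor
  · exact fun h x => ⟨h (Relation.EqvGen.rel _ _ (Or.inl rfl)),
      h (Relation.EqvGen.rel _ _ (Or.inr rfl))⟩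
  · intro h
    refine Setoid.eqvGen_le ?_
    rintro x _ (rfl | rfl)
    · exact (h x).1
    · exact (h x).2

/-- The Euler bound for the numbers of cycles of `γ` and `γ * s`, where `s` is an involution with
`2 * m` points in its support. -/
theorem numClasses_mul_involution_le (γ : Equiv.Perm E) (m : ℕ) (s : Equiv.Perm E)
    (hs : ∀ x, s (s x) = x) (hm : {x | s x ≠ x}.ncard = 2 * m) :
    numClasses (Equiv.Perm.SameCycle.setoid (γ * s)) +
      numClasses (Equiv.Perm.SameCycle.setoid γ) ≤ m + 2 * numClasses (generated γ s) := by
  induction m generalizing s with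
  | zero =>
    have h1 : s = 1 := by
      ext x
      by_contra hx
      have := (Set.ncard_eq_zero (Set.toFinite _)).1 hm
      exact (Set.eq_empty_iff_forall_notMem.1 this x) hx
    have h2 : numClasses (Equiv.Perm.SameCycle.setoid γ) ≤ numClasses (generated γ s) := by
      refine numClasses_le_of_le (generated_le_iff.2 fun x => ⟨?_, ?_⟩)
      · exact (⟨1, by simp⟩ : γ.SameCycle x (γ x))
      · rw [h1]
        exact Setoid.refl' _ x
    rw [h1, mul_one]
    rw [h1] at h2
    omega
  | succ m ih =>
    obtain ⟨a, ha⟩ : {x | s x ≠ x}.Nonempty := by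
      rw [← Set.ncard_pos]
      omega
    set b := s a with hb
    have hab : b ≠ a := ha
    have hsb : s b = a := hs a
    -- Removing one transposition leaves an involution that moves two points fewer.
    let t : Equiv.Perm E := s * Equiv.swap a b
    have hta : t a = a := by simp [t, hsb]
    have htb : t b = b := by simp [t, hb]
    have ht : ∀ x, x ≠ a → x ≠ b → t x = s x := fun x h1 h2 => by
      simp [t, Equiv.swap_apply_of_ne_of_ne h1 h2]
    have hst : s = t * Equiv.swap a b := by simp [t, mul_assoc]
    have htt : ∀ x, t (t x) = x := by
      intro x
      by_cases hxa : x = a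
      · rw [hxa, hta, hta]
      by_cases hxb : x = b
      · rw [hxb, htb, htb]
      rw [ht x hxa hxb, ht, hs]
      · intro h
        exact hxb (by rw [← hs x, h])
      · intro h
        exact hxa (by rw [← hs x, h, hsb])
    have hset : {x | s x ≠ x} = insert a (insert b {x | t x ≠ x}) := by
      ext x
      simp only [Set.mem_insert_iff, Set.mem_ofPred_eq]
      by_cases hxa : x = a
      · simp [hxa, ← hb, hab]
      by_cases hxb : x = b
      · simp [hxb, hsb, hab.symm]
      simp [hxa, hxb, ht x hxa hxb]
    have hcard : {x | t x ≠ x}.ncard = 2 * m := by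
      rw [hset, Set.ncard_insert_of_notMem, Set.ncard_insert_of_notMem] at hm
      · omega
      · simp [htb]
      · simp [hta, hab.symm]
    have hIH := ih t htt hcard
    have hγ : γ * s = γ * t * Equiv.swap a b := by rw [mul_assoc, ← hst]
    have hle : generated γ s ≤ joinPair (generated γ t) a b := by
      have hgen := (generated_le_iff (γ := γ) (s := t)).1 le_rfl
      refine generated_le_iff.2 fun x => ⟨le_joinPair _ a b (hgen x).1, ?_⟩
      by_cases hxa : x = a
      · rw [hxa, ← hb]
        exact joinPair_pair _ a b
      by_cases hxb : x = b
      · rw [hxb, hsb]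
        exact Setoid.symm' _ (joinPair_pair _ a b)
      · rw [← ht x hxa hxb]
        exact le_joinPair _ a b (hgen x).2
    have hle' := numClasses_le_of_le hle
    have hcyc : Equiv.Perm.SameCycle.setoid (γ * t) ≤ generated γ t := by
      have hgen := (generated_le_iff (γ := γ) (s := t)).1 le_rfl
      exact sameCycle_le_of_forall fun x => Setoid.trans' _ (hgen x).2 (hgen (t x)).1
    rw [hγ]
    -- If `a` and `b` already share an orbit, the orbits do not change and at most one cycle is
    -- gained, paid for by `m + 1`. Otherwise two cycles of `γ * t` merge, and this loss together
    -- with the increase of `m` pays for the one orbit that may be lost, which counts twice.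
    by_cases hj : generated γ t a b
    · have h1 := numClasses_mul_swap_le (γ * t) a b
      have h2 : numClasses (generated γ t) ≤ numClasses (joinPair (generated γ t) a b) :=
        numClasses_le_of_le (joinPair_le le_rfl hj)
      omega
    · have h1 := numClasses_mul_swap_lt (τ := γ * t) (a := a) (b := b) fun h => hj (hcyc h)
      have h2 := numClasses_le_joinPair_add_one (generated γ t) a b
      omega

/-- The number of colourings that are constant on the cycles of a permutation. -/
theorem card_invariant (τ : Equiv.Perm E) (N : ℕ) :
    Nat.card {c : E → Fin N // ∀ e, c (τ e) = c e} =
      N ^ numClasses (Equiv.Perm.SameCycle.setoid τ) := by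
  have hinv : ∀ c : E → Fin N, (∀ e, c (τ e) = c e) → ∀ x y, τ.SameCycle x y → c x = c y := by
    intro c hc x y hxy
    have := sameCycle_le_of_forall (τ := τ) (r := Setoid.ker c) (fun x => (hc x).symm) hxy
    exact this
  let F : {c : E → Fin N // ∀ e, c (τ e) = c e} ≃
      (Quotient (Equiv.Perm.SameCycle.setoid τ) → Fin N) :=
    { toFun := fun c => Quotient.lift c.1 (hinv c.1 c.2)
      invFun := fun c => ⟨fun e => c (Quotient.mk _ e), fun e =>
        congrArg c (Quotient.sound (Equiv.Perm.SameCycle.symm ⟨1, by simp⟩))⟩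
      left_inv := fun c => rfl
      right_inv := fun c => by
        funext x
        induction x using Quotient.inductionOn with
        | h a => rfl }
  rw [Nat.card_congr F, Nat.card_fun, Nat.card_fin]
  rfl

end

/-! ### Traces of products of matrices -/

section
variable {A : Type*} [Ring A] {N : ℕ}

/-- The sum runs over paths from `i` to `j` with interior vertices `c`: `cons` lists the starting
points of the steps and `snoc` their end points. -/
theorem list_prod_apply_eq_sum (m : ℕ) (M : Fin (m + 1) → Matrix (Fin N) (Fin N) A)
    (i j : Fin N) : (List.ofFn M).prod i j = ∑ c : Fin m → Fin N,
      (List.ofFn fun q => M q (Fin.cons (α := fun _ => Fin N) i c q)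
        (Fin.snoc (α := fun _ => Fin N) c j q)).prod := by
  induction m generalizing i with
  | zero => simp [Fin.snoc]
  | succ m ih =>
    rw [List.ofFn_succ, List.prod_cons, Matrix.mul_apply,
      ← (Fin.consEquiv fun _ : Fin (m + 1) => Fin N).sum_comp, Fintype.sum_prod_type]
    refine Finset.sum_congr rfl fun k _ => ?_
    rw [ih (fun q => M q.succ), Finset.mul_sum]
    refine Finset.sum_congr rfl fun c _ => ?_
    conv_rhs => rw [List.ofFn_succ, List.prod_cons]
    have hsnoc : ∀ q, Fin.snoc (α := fun _ => Fin N) (Fin.consEquiv (fun _ => Fin N) (k, c)) j q =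
        Fin.cons (α := fun _ => Fin N) k (Fin.snoc (α := fun _ => Fin N) c j) q := fun q =>
      (congrFun (Fin.cons_snoc_eq_snoc_cons k c j) q).symm
    simp only [hsnoc, Fin.consEquiv_apply, Fin.cons_succ, Fin.cons_zero]

/-- For a closed path the end of a step is the start of the cyclically next one. The empty word is
excluded: its trace is `N`, while the right-hand side would be `1`. -/
theorem trace_list_prod_eq_sum {l : ℕ} (hl : 0 < l) (M : Fin l → Matrix (Fin N) (Fin N) A) :
    Matrix.trace (List.ofFn M).prod = ∑ c : Fin l → Fin N,
      (List.ofFn fun q => M q (c q) (c (finRotate l q))).prod := by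
  obtain ⟨m, rfl⟩ : ∃ m, l = m + 1 := ⟨l - 1, by omega⟩
  rw [Matrix.trace, ← (Fin.consEquiv fun _ : Fin (m + 1) => Fin N).sum_comp,
    Fintype.sum_prod_type]
  refine Finset.sum_congr rfl fun i _ => ?_
  rw [Matrix.diag_apply, list_prod_apply_eq_sum]
  refine Finset.sum_congr rfl fun c _ => ?_
  simp only [Fin.consEquiv_apply, Fin.snoc_eq_cons_rotate]

end

/-! ### Pairings -/

section
variable {E : Type*} [LinearOrder E] [Fintype E] {P : Finset (Finset E)}

/-- A partition into pairs is given by an involution without fixed points. -/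
theorem IsNCP.exists_involution (hP : IsNCP P Finset.univ) (h2 : ∀ C ∈ P, C.card = 2) :
    ∃ s : Equiv.Perm E, (∀ e, s (s e) = e) ∧ (∀ e, s e ≠ e) ∧ (∀ e, {e, s e} ∈ P) := by
  have hex : ∀ e : E, ∃ e', e' ≠ e ∧ {e, e'} ∈ P := by
    intro e
    obtain ⟨C, hC, he⟩ := hP.cover e (Finset.mem_univ e)
    obtain ⟨x, y, hxy, rfl⟩ := Finset.card_eq_two.1 (h2 C hC)
    rcases Finset.mem_insert.1 he with rfl | h
    · exact ⟨y, hxy.symm, hC⟩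
    · obtain rfl := Finset.mem_singleton.1 h
      exact ⟨x, hxy, by rwa [Finset.pair_comm]⟩
  choose s hne hs using hex
  have hinv : Function.Involutive s := by
    intro e
    have h1 := hP.disj _ (hs e) _ (hs (s e)) (s e) (by simp) (by simp)
    have h3 : s (s e) ∈ ({e, s e} : Finset E) := by rw [h1]; simp
    rcases Finset.mem_insert.1 h3 with h | h
    · exact h
    · exact absurd (Finset.mem_singleton.1 h) (hne (s e))
  exact ⟨hinv.toPerm, hinv, hne, hs⟩

theorem IsNCP.card_eq_two_mul (hP : IsNCP P Finset.univ) (h2 : ∀ C ∈ P, C.card = 2) :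
    Fintype.card E = 2 * P.card := by
  have h1 : (Finset.univ : Finset E) = P.biUnion id := by
    ext e
    simpa using hP.cover e (Finset.mem_univ e)
  have h3 : ∑ C ∈ P, (id C).card = ∑ C ∈ P, 2 := Finset.sum_congr rfl h2
  rw [← Finset.card_univ, h1, Finset.card_biUnion, h3, Finset.sum_const, smul_eq_mul, mul_comm]
  intro B hB C hC hne
  exact Finset.disjoint_left.2 fun e he he' => hne (hP.disj B hB C hC e he he')

/-- The number of index functions that are compatible with a pairing. -/
theorem IsNCP.exists_card_compatible {r : ℕ} {p : E → Fin r}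
    (hp : Function.Surjective p) (hP : IsNCP P Finset.univ) (h2 : ∀ C ∈ P, C.card = 2)
    (hconn : Connects p P Finset.univ) (γ : Equiv.Perm E) (hγ : ∀ e, p (γ e) = p e)
    (hcyc : ∀ e e', p e = p e' → γ.SameCycle e e') :
    ∃ Q : ℕ, Q + r ≤ P.card + 2 ∧ ∀ N : ℕ,
      Nat.card {c : E → Fin N // ∀ C ∈ P, ∀ e ∈ C, ∀ e' ∈ C, e ≠ e' → c e = c (γ e')} = N ^ Q := by
  obtain ⟨s, hs, hne, hsP⟩ := hP.exists_involution h2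
  refine ⟨numClasses (Equiv.Perm.SameCycle.setoid (γ * s)), ?_, fun N => ?_⟩
  · have hsupp : {x | s x ≠ x}.ncard = 2 * P.card := by
      have : {x | s x ≠ x} = Set.univ := Set.eq_univ_of_forall hne
      rw [this, Set.ncard_univ, Nat.card_eq_fintype_card, hP.card_eq_two_mul h2]
    have h1 := numClasses_mul_involution_le γ P.card s hs hsupp
    have h3 : r ≤ numClasses (Equiv.Perm.SameCycle.setoid γ) := by
      let F : Quotient (Equiv.Perm.SameCycle.setoid γ) → Fin r :=
        Quotient.lift p fun a b hab =>
          (sameCycle_le_of_forall (τ := γ) (r := Setoid.ker p) fun x => (hγ x).symm) hab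
      have hF : Function.Surjective F := fun k => by
        obtain ⟨e, rfl⟩ := hp k
        exact ⟨Quotient.mk _ e, rfl⟩
      have := Nat.card_le_card_of_surjective F hF
      rwa [Nat.card_fin] at this
    have h4 : numClasses (generated γ s) ≤ 1 := by
      have hgen := (generated_le_iff (γ := γ) (s := s)).1 le_rfl
      have hcyc' : ∀ e e', p e = p e' → generated γ s e e' := fun e e' h =>
        sameCycle_le_of_forall (fun x => (hgen x).1) (hcyc e e' h)
      refine Finite.card_le_one_iff_subsingleton.2 ⟨?_⟩
      rintro ⟨a⟩ ⟨b⟩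
      refine Quotient.sound ?_
      classical
      -- The words all of whose letters lie in the orbit of `a` form a set that is saturated for the
      -- pairs, so connectedness makes it everything.
      have hS := hconn (Finset.univ.filter fun k => ∀ e, p e = k → generated γ s a e)
        (Finset.subset_univ _) ⟨p a, by simpa using fun e he => hcyc' a e he.symm⟩ (by
          intro C hC e he e' he' hm
          simp only [Finset.mem_filter, Finset.mem_univ, true_and] at hm ⊢
          intro d hd
          refine Setoid.trans' _ (Setoid.trans' _ (hm e rfl) ?_) (hcyc' e' d hd.symm)
          obtain rfl := hP.disj C hC _ (hsP e) e he (by simp)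
          rcases Finset.mem_insert.1 he' with rfl | h
          · exact Setoid.refl' _ _
          · rw [Finset.mem_singleton.1 h]
            exact (hgen e).2)
      have := hS ▸ Finset.mem_univ (p b)
      exact (Finset.mem_filter.1 this).2 b rfl
    omega
  · rw [← card_invariant]
    -- Compatibility with the pair `{e, s e}` says that `c e = c (γ (s e))`, that is, invariance
    -- under `γ * s`.
    refine Nat.card_congr (Equiv.subtypeEquivRight fun c => ⟨fun h e => ?_, fun h => ?_⟩)
    · exact (h _ (hsP e) e (by simp) (s e) (by simp) (hne e).symm).symm
    · intro C hC e he e' he' hee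
      obtain rfl := hP.disj C hC _ (hsP e) e he (by simp)
      rcases Finset.mem_insert.1 he' with rfl | h'
      · exact absurd rfl hee
      · rw [Finset.mem_singleton.1 h']
        exact (h e).symm

end

/-! ### Sequences of Laurent type -/

/-- The sequences that agree, from the first term on, with Laurent polynomials in `N` of degree
at most `d`. -/
noncomputable def laurentLE (d : ℤ) : Submodule ℂ (ℕ → ℂ) :=
  Submodule.span ℂ {g | ∃ (a : ℂ) (k : ℤ), k ≤ d ∧ ∀ N : ℕ, 1 ≤ N → g N = a * (N : ℂ) ^ k}

theorem mem_laurentLE_of_eq {d : ℤ} {g : ℕ → ℂ} (a : ℂ) (k : ℤ) (hk : k ≤ d)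
    (h : ∀ N : ℕ, 1 ≤ N → g N = a * (N : ℂ) ^ k) : g ∈ laurentLE d :=
  Submodule.subset_span ⟨a, k, hk, h⟩

theorem isBigO_of_mem_laurentLE {d : ℤ} {g : ℕ → ℂ} (hg : g ∈ laurentLE d) :
    g =O[atTop] fun N : ℕ => (N : ℝ) ^ d := by
  induction hg using Submodule.span_induction with
  | mem g hg =>
    obtain ⟨a, k, hk, h⟩ := hg
    refine IsBigO.of_bound ‖a‖ ?_
    filter_upwards [eventually_ge_atTop 1] with N hN
    rw [h N hN, norm_mul, norm_zpow, norm_zpow, Complex.norm_natCast, Real.norm_natCast]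
    exact mul_le_mul_of_nonneg_left (zpow_le_zpow_right₀ (by exact_mod_cast hN) hk) (norm_nonneg a)
  | zero => exact isBigO_zero _ _
  | add g h _ _ hg hh => exact hg.add hh
  | smul c g _ hg => exact hg.const_smul_left c

theorem tendsto_zero_of_mem_laurentLE {d : ℤ} (hd : d < 0) {g : ℕ → ℂ} (hg : g ∈ laurentLE d) :
    Tendsto g atTop (𝓝 0) := by
  refine (isBigO_of_mem_laurentLE hg).trans_tendsto ?_
  exact (tendsto_zpow_atTop_zero hd).comp tendsto_natCast_atTop_atTop

theorem exists_tendsto_of_mem_laurentLE {g : ℕ → ℂ} (hg : g ∈ laurentLE 0) :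
    ∃ L : ℂ, Tendsto g atTop (𝓝 L) := by
  induction hg using Submodule.span_induction with
  | mem g hg =>
    obtain ⟨a, k, hk, h⟩ := hg
    rcases hk.lt_or_eq with hk | rfl
    · exact ⟨0, tendsto_zero_of_mem_laurentLE hk (mem_laurentLE_of_eq a k le_rfl h)⟩
    · refine ⟨a, tendsto_const_nhds.congr' ?_⟩
      filter_upwards [eventually_ge_atTop 1] with N hN
      rw [h N hN, zpow_zero, mul_one]
  | zero => exact ⟨0, tendsto_const_nhds⟩
  | add g h _ _ hg hh =>
    obtain ⟨L, hL⟩ := hg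
    obtain ⟨L', hL'⟩ := hh
    exact ⟨L + L', hL.add hL'⟩
  | smul c g _ hg =>
    obtain ⟨L, hL⟩ := hg
    exact ⟨c • L, hL.const_smul c⟩

theorem one_div_mul_mem_laurentLE {d : ℤ} {g : ℕ → ℂ} (hg : g ∈ laurentLE d) :
    (fun N : ℕ => (1 / (N : ℂ)) * g N) ∈ laurentLE (d - 1) := by
  induction hg using Submodule.span_induction with
  | mem g hg =>
    obtain ⟨a, k, hk, h⟩ := hg
    refine mem_laurentLE_of_eq a (k - 1) (by omega) fun N hN => ?_
    have hN' : (N : ℂ) ≠ 0 := Nat.cast_ne_zero.2 (by omega)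
    rw [h N hN, zpow_sub_one₀ hN']
    ring
  | zero =>
    simp only [Pi.zero_apply, mul_zero]
    exact Submodule.zero_mem _
  | add g h _ _ hg hh =>
    simp only [Pi.add_apply, mul_add]
    exact Submodule.add_mem _ hg hh
  | smul c g _ hg =>
    have := Submodule.smul_mem _ c hg
    convert this using 1
    funext N
    simp only [Pi.smul_apply, smul_eq_mul]
    ring

/-! ### Free cumulants of traces of words -/

section
variable {A : Type*} [CStarAlgebra A] {φ : A →ₗ[ℂ] ℂ}
  {H : Type*} [NormedAddCommGroup H] [InnerProductSpace ℝ H]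
  {S : (N : ℕ) → (ℂ ⊗[ℝ] H) →ₗ[ℂ] Matrix (Fin N) (Fin N) A}
  {E : Type*} [LinearOrder E] [Fintype E]

theorem IsSemicircularEnsemble.cum_eq_zero (hS : IsSemicircularEnsemble φ S) (hφ : φ 1 = 1)
    {N : ℕ} (f : E → ℂ ⊗[ℝ] H) (i j : E → Fin N) {C : Finset E} (hC : C.Nonempty)
    (h2 : C.card ≠ 2) : cum φ (fun e => S N (f e) (i e) (j e)) C = 0 :=
  hS.freeCumulant_entries hφ hC.card_pos h2 _ _ _

theorem sum_eq_card_mul {X : Type*} [Fintype X] {K : ℂ} (q : X → Prop) (g : X → ℂ)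
    (h1 : ∀ x, q x → g x = K) (h0 : ∀ x, ¬ q x → g x = 0) :
    ∑ x, g x = (Nat.card {x // q x} : ℂ) * K := by
  classical
  rw [Nat.card_eq_fintype_card, Fintype.card_subtype, ← nsmul_eq_mul, ← Finset.sum_const,
    Finset.sum_filter]
  refine Finset.sum_congr rfl fun x _ => ?_
  split_ifs with h
  · exact h1 x h
  · exact h0 x h

open Classical in
/-- The covariance of the two letters of a pair. -/
noncomputable def pairWeight (f : E → ℂ ⊗[ℝ] H) (C : Finset E) : ℂ :=
  if h : C.Nonempty then pairing (f (C.min' h)) (f (C.max' h)) else 0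

open Classical in
theorem IsSemicircularEnsemble.cum_of_card_eq_two (hS : IsSemicircularEnsemble φ S)
    (hφ : φ 1 = 1) {N : ℕ} (f : E → ℂ ⊗[ℝ] H) (c : E → Fin N) (γ : Equiv.Perm E)
    {C : Finset E} (h2 : C.card = 2) :
    cum φ (fun e => S N (f e) (c e) (c (γ e))) C =
      if ∀ e ∈ C, ∀ e' ∈ C, e ≠ e' → c e = c (γ e') then (1 / (N : ℂ)) * pairWeight f C else 0 := by
  obtain ⟨x, y, hxy, rfl⟩ : ∃ x y, x < y ∧ C = {x, y} := by
    obtain ⟨x, y, hxy, rfl⟩ := Finset.card_eq_two.1 h2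
    rcases lt_or_gt_of_ne hxy with h | h
    · exact ⟨x, y, h, rfl⟩
    · exact ⟨y, x, h, Finset.pair_comm x y⟩
  -- The entries are centered because their cumulants of order one vanish.
  have hcenter : ∀ e, φ (S N (f e) (c e) (c (γ e))) = 0 := fun e => by
    have h := cum_singleton φ (fun e => S N (f e) (c e) (c (γ e))) e
    rw [← h]
    exact hS.cum_eq_zero hφ f c (fun e => c (γ e)) (Finset.singleton_nonempty e) (by simp)
  rw [cum_pair φ _ hcenter hxy, hS.covariance]
  have hw : pairWeight f {x, y} = pairing (f x) (f y) := by
    have hne : ({x, y} : Finset E).Nonempty := ⟨x, by simp⟩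
    rw [pairWeight, dif_pos hne, Finset.min'_pair, Finset.max'_pair, min_eq_left hxy.le,
      max_eq_right hxy.le]
  rw [hw]
  refine if_congr ?_ rfl rfl
  constructor
  · rintro ⟨h1, h2⟩ e he e' he' hne
    simp only [Finset.mem_insert, Finset.mem_singleton] at he he'
    rcases he with rfl | rfl <;> rcases he' with rfl | rfl
    · exact absurd rfl hne
    · exact h1
    · exact h2.symm
    · exact absurd rfl hne
  · intro h
    exact ⟨h x (by simp) y (by simp) hxy.ne, (h y (by simp) x (by simp) hxy.ne').symm⟩

/-- The contribution of a connected non-crossing partition is a monomial. -/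
theorem IsSemicircularEnsemble.sum_prod_cum_mem (hS : IsSemicircularEnsemble φ S) (hφ : φ 1 = 1)
    {r : ℕ} {p : E → Fin r} (hp : Function.Surjective p) (f : E → ℂ ⊗[ℝ] H)
    (γ : Equiv.Perm E) (hγ : ∀ e, p (γ e) = p e) (hcyc : ∀ e e', p e = p e' → γ.SameCycle e e')
    {P : Finset (Finset E)} (hP : IsNCP P Finset.univ) (hconn : Connects p P Finset.univ) :
    (fun N : ℕ => ∑ c : E → Fin N, ∏ C ∈ P, cum φ (fun e => S N (f e) (c e) (c (γ e))) C) ∈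
      laurentLE (2 - r) := by
  classical
  by_cases h2 : ∀ C ∈ P, C.card = 2
  · obtain ⟨Q, hQ, hcard⟩ := hP.exists_card_compatible hp h2 hconn γ hγ hcyc
    -- There are `N ^ Q` compatible index functions, and each of the `P.card` pairs contributes a
    -- factor `1 / N`.
    refine mem_laurentLE_of_eq (∏ C ∈ P, pairWeight f C) ((Q : ℤ) - P.card) (by omega)
      fun N hN => ?_
    have hN' : (N : ℂ) ≠ 0 := Nat.cast_ne_zero.2 (by omega)
    rw [sum_eq_card_mul (K := ∏ C ∈ P, ((1 / (N : ℂ)) * pairWeight f C))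
      (fun c : E → Fin N => ∀ C ∈ P, ∀ e ∈ C, ∀ e' ∈ C, e ≠ e' → c e = c (γ e')) _
      (fun c hc => Finset.prod_congr rfl fun C hC =>
        (hS.cum_of_card_eq_two hφ f c γ (h2 C hC)).trans (if_pos (hc C hC)))
      (fun c hc => by
        push Not at hc
        obtain ⟨C, hC, hc⟩ := hc
        refine Finset.prod_eq_zero hC
          ((hS.cum_of_card_eq_two hφ f c γ (h2 C hC)).trans (if_neg fun h => ?_))
        obtain ⟨e, he, e', he', hne, hee⟩ := hc
        exact hee (h e he e' he' hne)),
      hcard N, Finset.prod_mul_distrib, Finset.prod_const,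
      zpow_sub₀ hN', zpow_natCast, zpow_natCast]
    push_cast
    rw [one_div, inv_pow]
    ring
  · push Not at h2
    obtain ⟨C, hC, hC2⟩ := h2
    refine mem_laurentLE_of_eq 0 (2 - r) le_rfl fun N _ => ?_
    rw [zero_mul]
    refine Finset.sum_eq_zero fun c _ => Finset.prod_eq_zero hC ?_
    exact hS.cum_eq_zero hφ f c (fun e => c (γ e)) (hP.nonempty C hC) hC2

theorem orderedProd_map {A : Type*} [Ring A] {F : Type*} [LinearOrder F] (g : F ↪o E)
    (x : E → A) (D : Finset F) :
    orderedProd x (D.map g.toEmbedding) = orderedProd (fun i => x (g i)) D := by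
  have h : (D.map g.toEmbedding).sort = D.sort.map g :=
    (Finset.map_sort _ _ _ _ fun a _ b _ => g.le_iff_le.symm).symm
  rw [orderedProd, h, List.map_map]
  rfl

theorem finRotate_sameCycle {l : ℕ} (q q' : Fin l) : (finRotate l).SameCycle q q' := by
  obtain ⟨m, rfl⟩ : ∃ m, l = m + 1 := ⟨l - 1, by have := q.2; omega⟩
  have key : ∀ q : Fin (m + 1), (finRotate (m + 1)).SameCycle 0 q := by
    intro q
    induction q using Fin.induction with
    | zero => exact Equiv.Perm.SameCycle.refl _ _
    | succ i ih =>
      have h : finRotate (m + 1) i.castSucc = i.succ := by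
        rw [finRotate_apply, Fin.coeSucc_eq_succ]
      rw [← h]
      exact ih.trans ⟨1, by simp⟩
  exact (key q).symm.trans (key q')

/-- The rotation of every word. -/
def rotateWords {r : ℕ} (l : Fin r → ℕ) : Equiv.Perm (Σₗ k : Fin r, Fin (l k)) :=
  (ofLex.trans (Equiv.sigmaCongrRight fun k => finRotate (l k))).trans toLex

/-- The free cumulants of traces of words are of Laurent type. -/
theorem IsSemicircularEnsemble.freeCumulant_trace_mem (hS : IsSemicircularEnsemble φ S)
    (hφ : φ 1 = 1) {r : ℕ} (hr : 1 ≤ r) (l : Fin r → ℕ) (hl : ∀ k, 0 < l k)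
    (f : (k : Fin r) → Fin (l k) → ℂ ⊗[ℝ] H) :
    (fun N : ℕ => freeCumulant φ r fun k =>
      Matrix.trace (List.ofFn fun q => S N (f k q)).prod) ∈ laurentLE (2 - r) := by
  -- Letters are ordered lexicographically, which is their reading order; `p` sends a letter to its
  -- word and is therefore monotone.
  let p : (Σₗ k : Fin r, Fin (l k)) → Fin r := fun e => (ofLex e).1
  have hp : Monotone p := fun a b h => by
    rcases (Sigma.Lex.le_def).1 h with h | ⟨h, -⟩
    · exact h.le
    · exact h.le
  let F : (Σₗ k : Fin r, Fin (l k)) → ℂ ⊗[ℝ] H := fun e => f (ofLex e).1 (ofLex e).2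
  have hfiber : ∀ (k : Fin r) (x : (Σₗ k : Fin r, Fin (l k)) → A),
      orderedProd x (fiberOver p {k}) = (List.ofFn fun q : Fin (l k) => x (toLex ⟨k, q⟩)).prod := by
    intro k x
    let g : Fin (l k) ↪o (Σₗ k : Fin r, Fin (l k)) :=
      OrderEmbedding.ofStrictMono (fun q => toLex ⟨k, q⟩) fun a b h =>
        Sigma.Lex.lt_def.2 (Or.inr ⟨rfl, h⟩)
    have hg : fiberOver p {k} = Finset.univ.map g.toEmbedding := by
      ext e
      rw [mem_fiberOver, Finset.mem_singleton]
      constructor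
      · rintro rfl
        exact Finset.mem_map.2 ⟨(ofLex e).2, Finset.mem_univ _, rfl⟩
      · intro h
        obtain ⟨q, -, rfl⟩ := Finset.mem_map.1 h
        rfl
    rw [hg, orderedProd_map, orderedProd_univ]
    rfl
  have hsum : ∀ N : ℕ, (freeCumulant φ r fun k =>
      Matrix.trace (List.ofFn fun q => S N (f k q)).prod) =
      ∑ P ∈ connectedNcp p Finset.univ, ∑ c : (Σₗ k : Fin r, Fin (l k)) → Fin N,
        ∏ C ∈ P, cum φ (fun e => S N (F e) (c e) (c (rotateWords l e))) C := by
    intro N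
    rw [Finset.sum_comm]
    simp_rw [trace_list_prod_eq_sum (hl _)]
    have h1 := (cumulantMultilinear φ r).map_sum
      (g := fun (k : Fin r) (c : Fin (l k) → Fin N) =>
        (List.ofFn fun q => S N (f k q) (c q) (c (finRotate (l k) q))).prod)
    refine h1.trans ?_
    -- An index function on all letters is the same as one index function for each word.
    let e : ((Σₗ k : Fin r, Fin (l k)) → Fin N) ≃ ((k : Fin r) → Fin (l k) → Fin N) :=
      (Equiv.arrowCongr ofLex (Equiv.refl _)).trans (Equiv.piCurry fun _ _ => Fin N)
    rw [← e.sum_comp]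
    refine Finset.sum_congr rfl fun c _ => ?_
    rw [← cum_orderedProd φ hφ hp _ _ ⟨⟨0, hr⟩, Finset.mem_univ _⟩, cum_univ,
      cumulantMultilinear_apply]
    simp only [hfiber]
    rfl
  simp only [hsum]
  have hfun : (fun N : ℕ => ∑ P ∈ connectedNcp p Finset.univ,
      ∑ c : (Σₗ k : Fin r, Fin (l k)) → Fin N,
        ∏ C ∈ P, cum φ (fun e => S N (F e) (c e) (c (rotateWords l e))) C) =
      ∑ P ∈ connectedNcp p Finset.univ, fun N : ℕ =>
        ∑ c : (Σₗ k : Fin r, Fin (l k)) → Fin N,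
          ∏ C ∈ P, cum φ (fun e => S N (F e) (c e) (c (rotateWords l e))) C := by
    funext N
    rw [Finset.sum_apply]
  rw [hfun]
  refine Submodule.sum_mem _ fun P hP => ?_
  obtain ⟨hP1, hP2⟩ := mem_connectedNcp.1 hP
  have huniv : fiberOver p (Finset.univ : Finset (Fin r)) = Finset.univ := by
    ext e
    simp [mem_fiberOver]
  rw [huniv] at hP1
  refine hS.sum_prod_cum_mem hφ (fun k => ⟨toLex ⟨k, ⟨0, hl k⟩⟩, rfl⟩) F (rotateWords l)
    (fun e => rfl) ?_ hP1 hP2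
  rintro ⟨k, q⟩ ⟨k', q'⟩ h
  obtain rfl : k = k' := h
  obtain ⟨n, hn⟩ := (finRotate_sameCycle q q').exists_nat_pow_eq
  refine ⟨(n : ℤ), ?_⟩
  rw [zpow_natCast]
  have hpow : ∀ n : ℕ, (rotateWords l ^ n) (toLex ⟨k, q⟩) =
      toLex ⟨k, (finRotate (l k) ^ n) q⟩ := by
    intro n
    induction n with
    | zero => rfl
    | succ n ih =>
      rw [pow_succ', Equiv.Perm.mul_apply, ih, pow_succ', Equiv.Perm.mul_apply]
      rfl
  refine (hpow n).trans ?_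
  rw [hn]
  rfl

end

/-! ### Traces of polynomials -/

theorem freeAlgebra_span_words (n : ℕ) :
    Submodule.span ℂ (Set.range fun w : List (Fin n) =>
      (w.map (FreeAlgebra.ι ℂ)).prod) = (⊤ : Submodule ℂ (FreeAlgebra ℂ (Fin n))) := by
  rw [← Algebra.top_toSubmodule, ← FreeAlgebra.adjoin_range_ι, Algebra.adjoin_eq_span]
  congr 1
  ext x
  constructor
  · rintro ⟨w, rfl⟩
    refine Submonoid.list_prod_mem _ fun y hy => ?_
    obtain ⟨j, -, rfl⟩ := List.mem_map.1 hy
    exact Submonoid.subset_closure ⟨j, rfl⟩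
  · intro hx
    obtain ⟨L, hL, rfl⟩ := Submonoid.exists_list_of_mem_closure hx
    obtain ⟨w, rfl⟩ : L ∈ Set.range (List.map (FreeAlgebra.ι ℂ)) := by
      rw [Set.range_list_map]
      exact hL
    exact ⟨w, rfl⟩

section
variable {A : Type*} [CStarAlgebra A] {φ : A →ₗ[ℂ] ℂ}
  {H : Type*} [NormedAddCommGroup H] [InnerProductSpace ℝ H]
  {S : (N : ℕ) → (ℂ ⊗[ℝ] H) →ₗ[ℂ] Matrix (Fin N) (Fin N) A}

theorem polyTrace_word {n : ℕ} (f : Fin n → ℂ ⊗[ℝ] H) (w : List (Fin n)) (N : ℕ) :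
    polyTrace (fun (f : ℂ ⊗[ℝ] H) (N : ℕ) => S N f) f ((w.map (FreeAlgebra.ι ℂ)).prod) N =
      Matrix.trace (List.ofFn fun q : Fin w.length => S N (f (w.get q))).prod := by
  have h : w.map (fun j => S N (f j)) = List.ofFn fun q : Fin w.length => S N (f (w.get q)) := by
    conv_lhs => rw [← List.ofFn_get w, List.map_ofFn]
    rfl
  rw [polyTrace, map_list_prod, List.map_map, ← h]
  congr 3
  funext j
  simp

/-- The trace of a polynomial as a linear map. -/
noncomputable def polyTraceLinear {I : Type*} (M : I → (N : ℕ) → Matrix (Fin N) (Fin N) A) {n : ℕ}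
    (i : Fin n → I) (N : ℕ) : FreeAlgebra ℂ (Fin n) →ₗ[ℂ] A :=
  (Matrix.traceLinearMap (Fin N) ℂ A).comp
    (FreeAlgebra.lift ℂ fun j => M (i j) N : FreeAlgebra ℂ (Fin n) →ₐ[ℂ] _).toLinearMap

theorem IsSemicircularEnsemble.freeCumulant_polyTrace_mem (hS : IsSemicircularEnsemble φ S)
    (hφ : φ 1 = 1) {r : ℕ} (hr : 2 ≤ r) {n : ℕ} (f : Fin n → ℂ ⊗[ℝ] H)
    (p : Fin r → FreeAlgebra ℂ (Fin n)) :
    (fun N : ℕ => freeCumulant φ r fun k =>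
      polyTrace (fun (f : ℂ ⊗[ℝ] H) (N : ℕ) => S N f) f (p k) N) ∈ laurentLE (2 - r) := by
  let F : MultilinearMap ℂ (fun _ : Fin r => FreeAlgebra ℂ (Fin n)) (ℕ → ℂ) :=
    MultilinearMap.pi fun N => (cumulantMultilinear φ r).compLinearMap fun _ =>
      polyTraceLinear (fun (f : ℂ ⊗[ℝ] H) (N : ℕ) => S N f) f N
  refine multilinear_mem_of_span F _ (fun _ => Set.range fun w : List (Fin n) =>
      (w.map (FreeAlgebra.ι ℂ)).prod) (fun x hx => ?_) p
    (fun k => by rw [freeAlgebra_span_words]; trivial)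
  choose w hw using hx
  obtain rfl := funext hw
  change (fun N : ℕ => freeCumulant φ r fun k =>
      polyTrace (fun (f : ℂ ⊗[ℝ] H) (N : ℕ) => S N f) f ((w k).map (FreeAlgebra.ι ℂ)).prod N) ∈ _
  simp only [polyTrace_word]
  by_cases hl : ∀ k, 0 < (w k).length
  · exact hS.freeCumulant_trace_mem hφ (by omega) (fun k => (w k).length) hl
      fun k q => f ((w k).get q)
  -- Some word is empty and its trace is the scalar `N • 1`, so the cumulant vanishes because its
  -- order is at least two.
  · push Not at hl
    obtain ⟨k, hk⟩ := hl
    have hwk : w k = [] := List.eq_nil_of_length_eq_zero (Nat.le_zero.1 hk)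
    refine mem_laurentLE_of_eq 0 (2 - r) le_rfl fun N _ => ?_
    rw [zero_mul]
    obtain ⟨m, rfl⟩ : ∃ m, r = m + 2 := ⟨r - 2, by omega⟩
    set X : Fin (m + 2) → A := fun k => Matrix.trace
      (List.ofFn fun q : Fin (w k).length => S N (f ((w k).get q))).prod with hX
    have hXk : X k = (N : ℂ) • (1 : A) := by
      have h1 : ∀ v : List (Fin n), v = [] → Matrix.trace
          (List.ofFn fun q : Fin v.length => S N (f (v.get q))).prod = (N : ℂ) • (1 : A) := by
        rintro v rfl
        simp [Matrix.trace_one, Nat.cast_smul_eq_nsmul]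
      exact h1 _ hwk
    have h2 : X = Function.update X k ((N : ℂ) • (1 : A)) := by
      rw [← hXk, Function.update_eq_self]
    rw [← cumulantMultilinear_apply, h2, MultilinearMap.map_update_smul,
      cumulantMultilinear_apply, freeCumulant_eq_zero_of_eq_one φ hφ _ k
        (Function.update_self _ _ _), smul_zero]

theorem IsSemicircularEnsemble.hasLimitDistribution (hS : IsSemicircularEnsemble φ S)
    (hφ : φ 1 = 1) :
    HasLimitDistribution φ (fun (f : ℂ ⊗[ℝ] H) (N : ℕ) => S N f) := by
  intro n f
  rcases Nat.eq_zero_or_pos n with rfl | hn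
  · refine ⟨1, tendsto_const_nhds.congr' ?_⟩
    filter_upwards [eventually_ge_atTop 1] with N hN
    have hN' : (N : ℂ) ≠ 0 := Nat.cast_ne_zero.2 (by omega)
    have h1 : φ (N : A) = N := by
      rw [← nsmul_one, map_nsmul, hφ, nsmul_one]
    simp [Matrix.trace_one, h1, hN']
  -- The expectation is the cumulant of order one, of degree at most `2 - 1`; the normalization `1 /
  -- N` brings this down to `0`.
  · have h := one_div_mul_mem_laurentLE (hS.freeCumulant_trace_mem hφ le_rfl (fun _ : Fin 1 => n)
      (fun _ => hn) fun _ => f)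
    have h1 : ((2 : ℤ) - (1 : ℕ) - 1) = 0 := by norm_num
    rw [h1] at h
    have h2 : ∀ N : ℕ, (freeCumulant φ 1 fun _ => Matrix.trace
        (List.ofFn fun q => S N (f q)).prod) =
        φ (Matrix.trace (List.ofFn fun q => S N (f q)).prod) := fun N =>
      cum_singleton φ (fun _ : Fin 1 => Matrix.trace (List.ofFn fun q => S N (f q)).prod) 0
    simp only [h2] at h
    exact exists_tendsto_of_mem_laurentLE h

end

end FreeSemicircular

/-! ### The theorem -/

theorem theorem3p1 {A : Type*} [CStarAlgebra A] (φ : A →ₗ[ℂ] ℂ)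
    (hφ : FreeSemicircular.IsState φ)
    {H : Type*} [NormedAddCommGroup H] [InnerProductSpace ℝ H] [CompleteSpace H]
    (S : (N : ℕ) → (ℂ ⊗[ℝ] H) →ₗ[ℂ] Matrix (Fin N) (Fin N) A)
    (hS : FreeSemicircular.IsSemicircularEnsemble φ S) :
    (∀ (r : ℕ), 1 ≤ r → ∀ l : Fin r → ℕ, (∀ k, 0 < l k) →
      ∀ f : (k : Fin r) → Fin (l k) → ℂ ⊗[ℝ] H,
        (fun N : ℕ => FreeSemicircular.freeCumulant φ r fun k =>
            Matrix.trace (List.ofFn fun p => S N (f k p)).prod)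
          =O[atTop] fun N : ℕ => (N : ℝ) ^ ((2 : ℤ) - (r : ℤ))) ∧
    FreeSemicircular.HasSecondOrderFreeLimitDistribution φ
      (fun (f : ℂ ⊗[ℝ] H) (N : ℕ) => S N f) := by
  refine ⟨fun r hr l hl f => FreeSemicircular.isBigO_of_mem_laurentLE
    (hS.freeCumulant_trace_mem hφ.map_one hr l hl f), hS.hasLimitDistribution hφ.map_one,
    fun n f => ⟨fun p => ?_, fun r hr p => ?_⟩⟩
  · exact FreeSemicircular.exists_tendsto_of_mem_laurentLE
      (hS.freeCumulant_polyTrace_mem hφ.map_one le_rfl f p)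
  · exact FreeSemicircular.tendsto_zero_of_mem_laurentLE (by omega)
      (hS.freeCumulant_polyTrace_mem hφ.map_one (by omega) f p)
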